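/- **Theorem (a $D_n$ Jackson sum).** For $|p|<1$ and $z\in\mathbb C\setminus\{0\}$ let $\theta(z;p)=\prod_{j\ge0}(1-zp^j)(1-p^{j+1}/z)$, and for an integer $k\ge 0$ let $(z;q,p)_k=\prod_{j=0}^{k-1}\theta(zq^j;p)$ and $(z_1,\dots,z_m;q,p)_k=(z_1;q,p)_k\cdots(z_m;q,p)_k$. For $\boldsymbol k=(k_1,\dots,k_n)$ write $|\boldsymbol k|=k_1+\cdots+k_n$. Let $n\ge1$ and $N\ge0$ be integers, let $p,\tilde p\in\mathbb C$ with $|p|<1$, $|\tilde p|<1$, and let $q,\tilde q,\,x_1,\dots,x_n,\,y_1,\dots,y_{n-1},\,g,a,b,c,d$ be nonzero complex numbers such that none of the denominators on the left-hand side below vanishes. Then $$ \begin{aligned} &\sum_{\substack{k_1,\dots,k_n\ge0\\ 0\le|\boldsymbol k|\le N}}\Bigg( \prod_{1\le r<s\le n}\frac{\theta(q^{k_r-k_s}x_r/x_s;p)}{\theta(x_r/x_s;p)\,(x_rx_s;q,p)_{k_r+k_s}} \prod_{s=1}^{n-1}\frac{\prod_{r=1}^n(x_ry_s,x_r/y_s;q,p)_{k_r}}{(gy_s,g/y_s;q,p)_{|\boldsymbol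 k|}}\\ &\qquad\times\prod_{r=1}^n\frac{(gx_r;q,p)_{|\boldsymbol k|}\,(g/x_r;q,p)_{|\boldsymbol k|-k_r}} {(gx_r;q,p)_{k_r}\prod_{s=1}^n(qx_r/x_s;q,p)_{k_r}}\cdot q^{\sum_{r=1}^n(r-1)k_r}\,(q;q,p)_{|\boldsymbol k|}\\ &\qquad\times\frac{\theta(a\tilde q^{2|\boldsymbol k|};\tilde p)}{\theta(a;\tilde p)}\, \frac{(a,b,c,d,a^2\tilde q^{1+N}/bcd,\tilde q^{-N};\tilde q,\tilde p)_{|\boldsymbol k|}} {(\tilde q,a\tilde q/b,a\tilde q/c,a\tilde q/d,bcd\tilde q^{-N}/a,a\tilde q^{N+1};\tilde q,\tilde p)_{|\boldsymbol k|}}\, \tilde q^{|\boldsymbol k|}\Bigg)\\ &\quad=\frac{(a\tilde q,a\tilde q/bc,a\tilde q/bd,a\tilde q/cd;\tilde q,\tilde p)_N} {(a\tilde q/b,a\tilde q/c,a\tilde q/d,a\tilde q/bcd;\tilde q,\tilde p)_N}. \end{aligned} $$ -/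

import Mathlib

/-- The infinite `p`-shifted factorial `(a; p)_∞ = ∏_{j ≥ 0} (1 - a p^j)` (used for `|p| < 1`). -/
noncomputable def pochInf (a p : ℂ) : ℂ := ∏' j : ℕ, (1 - a * p ^ j)

/-- For `|p| < 1` the product defining `(a; p)_∞` converges (unconditionally). -/
theorem multipliable_pochInf (a p : ℂ) (hp : ‖p‖ < 1) :
    Multipliable fun j : ℕ => (1 - a * p ^ j) := by
  have h : Summable fun j : ℕ => ‖-(a * p ^ j)‖ := by
    simp only [norm_neg, norm_mul, norm_pow]
    exact (summable_geometric_of_lt_one (norm_nonneg p) hp).mul_left _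
  simpa [sub_eq_add_neg] using multipliable_one_add_of_summable h

/-- The modified Jacobi theta function `θ(a; p) = (a; p)_∞ (p / a; p)_∞`
(used for `a ≠ 0` and `|p| < 1`). -/
noncomputable def ellTheta (a p : ℂ) : ℂ := pochInf a p * pochInf (p / a) p

/-- The `q,p`-shifted factorial `(a; q, p)_k = ∏_{j=0}^{k-1} θ(a q^j; p)`, for `k ≥ 0`. -/
noncomputable def ellFac (a q p : ℂ) (k : ℕ) : ℂ :=
  ∏ j ∈ Finset.range k, ellTheta (a * q ^ j) p

/-- The short-hand `(a₁, …, a_m; q, p)_k = (a₁; q, p)_k ⋯ (a_m; q, p)_k`. -/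
noncomputable def ellFacs (as : List ℂ) (q p : ℂ) (k : ℕ) : ℂ :=
  (as.map fun a => ellFac a q p k).prod

/-- The finite set of `n`-tuples `(k₁, …, k_n)` of nonnegative integers with
`k₁ + ⋯ + k_n ≤ N`. -/
def multiSimplex (n N : ℕ) : Finset (Fin n → ℕ) :=
  (Fintype.piFinset fun _ : Fin n => Finset.range (N + 1)).filter fun k => ∑ r, k r ≤ N

theorem mem_multiSimplex {n N : ℕ} {k : Fin n → ℕ} :
    k ∈ multiSimplex n N ↔ ∑ r, k r ≤ N := by
  simp only [multiSimplex, Finset.mem_filter, Fintype.mem_piFinset, Finset.mem_range,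
    and_iff_right_iff_imp]
  intro h r
  exact Nat.lt_succ_of_le ((Finset.single_le_sum (fun i _ => Nat.zero_le (k i))
    (Finset.mem_univ r)).trans h)

/-- The `D_n`-type factor, in base `q` and nome `p`, of the summand with index `k`.
Coordinates are numbered from `0`, so `q^{∑ (r-1) k_r}` reads `q ^ ∑ r, r * k r`. -/
noncomputable def dnFactor {n : ℕ} (q p g : ℂ) (x : Fin n → ℂ) (y : Fin (n - 1) → ℂ)
    (k : Fin n → ℕ) : ℂ :=
  (∏ r, ∏ s ∈ Finset.Ioi r,
      ellTheta (q ^ ((k r : ℤ) - (k s : ℤ)) * x r / x s) p /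
        (ellTheta (x r / x s) p * ellFac (x r * x s) q p (k r + k s))) *
    (∏ s, (∏ r, ellFacs [x r * y s, x r / y s] q p (k r)) /
        ellFacs [g * y s, g / y s] q p (∑ i, k i)) *
    (∏ r, ellFac (g * x r) q p (∑ i, k i) * ellFac (g / x r) q p ((∑ i, k i) - k r) /
        (ellFac (g * x r) q p (k r) * ∏ s, ellFac (q * x r / x s) q p (k r))) *
    q ^ (∑ r : Fin n, (r : ℕ) * k r) * ellFac q q p (∑ i, k i)

/-- The `K`-th term of the very-well-poised series
`₁₀V₉(a; b, c, d, a² q^{1+N} / (b c d), q^{-N}; q, p)`. -/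
noncomputable def tenVNineTerm (a b c d q p : ℂ) (N K : ℕ) : ℂ :=
  ellTheta (a * q ^ (2 * K)) p / ellTheta a p *
    (ellFacs [a, b, c, d, a ^ 2 * q ^ (1 + N) / (b * c * d), q ^ (-(N : ℤ))] q p K /
      ellFacs [q, a * q / b, a * q / c, a * q / d, b * c * d * q ^ (-(N : ℤ)) / a,
        a * q ^ (N + 1)] q p K) *
    q ^ K

/-! The two bases interact only through `|k|`: the very-well-poised factor depends on `k` through `K
= |k|` alone. The heart of the matter is that the `D_n` factors with `|k| = K` sum to `1` for every
`K ≤ N` (`sum_dnFactor_eq_one`). What remains is the one-variable Frenkel–Turaev sum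
(`sum_tenVNineTerm`).

The level sums are compared by transporting mass from level `K` to level `K + 1`. The weight at `k`
is split among the `k + e_i` in proportions `dnRaise`, and `k + e_i` receives a proportion `dnLower`
of its own weight (`dnFactor_mul_dnRaise`). Both sets of proportions sum to `1`: the first by a type
`D` partial fraction identity, the second by a type `A` one. Each is proved by induction on the
number of nodes from the Weierstrass three-term relation.

That relation rests on a dimension count: functions holomorphic on `ℂ ∖ {0}` with `h (p z) = h z / z
^ 2` form a space of dimension at most two.

The Frenkel–Turaev sum is itself the level sum for `n = 2`, `K = N`, after reversing the factorials
of length `N - k`. This needs `a` in general position; continuity in `a` removes the restriction. -/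

/-! ### Theta functions: inversion, quasi-periodicity, holomorphy, zeros -/

theorem summable_norm_pochInf (a : ℂ) {p : ℂ} (hp : ‖p‖ < 1) :
    Summable fun j : ℕ => ‖-(a * p ^ j)‖ := by
  simp only [norm_neg, norm_mul, norm_pow]
  exact (summable_geometric_of_lt_one (norm_nonneg p) hp).mul_left _

theorem pochInf_eq_mul (a : ℂ) {p : ℂ} (hp : ‖p‖ < 1) :
    pochInf a p = (1 - a) * pochInf (a * p) p := by
  have e : ∀ j : ℕ, 1 - a * p * p ^ j = 1 - a * p ^ (j + 1) := fun j => by ring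
  have h := multipliable_pochInf (a * p) p hp
  rw [pochInf, pochInf, tprod_congr e]
  rw [multipliable_congr e] at h
  rw [tprod_eq_zero_mul' (f := fun j : ℕ => 1 - a * p ^ j) h, pow_zero, mul_one]

theorem differentiable_pochInf {p : ℂ} (hp : ‖p‖ < 1) :
    Differentiable ℂ fun a => pochInf a p := by
  intro a
  have hK : IsOpen (Metric.ball (0 : ℂ) (‖a‖ + 1)) := Metric.isOpen_ball
  have h := Summable.hasProdLocallyUniformlyOn_nat_one_add (R := ℂ)
    (f := fun (j : ℕ) (z : ℂ) => -(z * p ^ j)) (u := fun j => (‖a‖ + 1) * ‖p‖ ^ j) hK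
    ((summable_geometric_of_lt_one (norm_nonneg p) hp).mul_left _)
    (Filter.Eventually.of_forall fun j z hz => by
      rw [norm_neg, norm_mul, norm_pow]
      exact mul_le_mul_of_nonneg_right (by simpa using (mem_ball_zero_iff.1 hz).le) (by positivity))
    (fun j => by fun_prop)
  have h2 := h.tendstoLocallyUniformlyOn_finsetRange.differentiableOn
    (Filter.Eventually.of_forall fun s => by fun_prop) hK
  have h3 := h2.differentiableAt (hK.mem_nhds (x := a) (by simp))
  simpa [pochInf, sub_eq_add_neg] using h3

theorem pochInf_eq_zero {a p : ℂ} (hp : ‖p‖ < 1) (h : pochInf a p = 0) :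
    ∃ j : ℕ, a * p ^ j = 1 := by
  by_contra! hne
  refine tprod_one_add_ne_zero_of_summable (f := fun j : ℕ => -(a * p ^ j))
    (fun j hj => hne j ?_) (summable_norm_pochInf a hp) (by simpa [pochInf, sub_eq_add_neg] using h)
  linear_combination -hj

theorem ellTheta_eq_mul {z p : ℂ} (hp : ‖p‖ < 1) :
    ellTheta z p = (1 - z) * pochInf (z * p) p * pochInf (p / z) p := by
  rw [ellTheta, pochInf_eq_mul z hp]

theorem ellTheta_one {p : ℂ} (hp : ‖p‖ < 1) : ellTheta 1 p = 0 := by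
  simp [ellTheta_eq_mul hp]

theorem ellTheta_inv {z p : ℂ} (hp : ‖p‖ < 1) (hz : z ≠ 0) :
    ellTheta z⁻¹ p = -ellTheta z p / z := by
  rw [ellTheta_eq_mul hp, ellTheta_eq_mul hp, div_inv_eq_mul, mul_comm p z, inv_mul_eq_div]
  field_simp
  ring

theorem ellTheta_div_comm {x y p : ℂ} (hp : ‖p‖ < 1) (hx : x ≠ 0) (hy : y ≠ 0) :
    ellTheta (y / x) p = -(y / x) * ellTheta (x / y) p := by
  rw [← inv_div, ellTheta_inv hp (div_ne_zero hx hy)]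
  field_simp

theorem ellTheta_mul_self {z p : ℂ} (hp : ‖p‖ < 1) (hp0 : p ≠ 0) (hz : z ≠ 0) :
    ellTheta (p * z) p = -ellTheta z p / z := by
  rw [ellTheta_eq_mul (z := z) hp, ellTheta, mul_comm p z, div_mul_cancel_right₀ hp0,
    pochInf_eq_mul z⁻¹ hp, inv_mul_eq_div]
  field_simp
  ring

theorem differentiableAt_ellTheta {z p : ℂ} (hp : ‖p‖ < 1) (hz : z ≠ 0) :
    DifferentiableAt ℂ (fun z => ellTheta z p) z := by
  unfold ellTheta
  exact ((differentiable_pochInf hp) z).mul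
    (((differentiable_pochInf hp) (p / z)).comp z (by fun_prop (disch := assumption)))

theorem countable_ellTheta_eq_zero {p : ℂ} (hp : ‖p‖ < 1) :
    {z : ℂ | z ≠ 0 ∧ ellTheta z p = 0}.Countable := by
  refine ((Set.countable_range fun j : ℕ => (p ^ j)⁻¹).union
    (Set.countable_range fun j : ℕ => p ^ (j + 1))).mono ?_
  rintro z ⟨hz, h⟩
  rcases mul_eq_zero.1 h with h | h
  · obtain ⟨j, hj⟩ := pochInf_eq_zero hp h
    exact Or.inl ⟨j, (eq_inv_of_mul_eq_one_left hj).symm⟩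
  · obtain ⟨j, hj⟩ := pochInf_eq_zero hp h
    refine Or.inr ⟨j, ?_⟩
    field_simp at hj
    simpa [pow_succ'] using hj

/-! ### Laurent coefficients of quasi-periodic functions -/

open Real in
-- On a circle about `0` one has `dz / z = i dθ`, so this is Cauchy's theorem on an annulus.
theorem integral_circleMap_eq_of_differentiableAt {G : ℂ → ℂ} (hG : ∀ z, z ≠ 0 → DifferentiableAt ℂ G z)
    {r R : ℝ} (hr : 0 < r) (hR : 0 < R) :
    ∫ θ in (0 : ℝ)..2 * π, G (circleMap 0 R θ) = ∫ θ in (0 : ℝ)..2 * π, G (circleMap 0 r θ) := by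
  wlog hle : r ≤ R generalizing r R
  · exact (this hR hr (le_of_not_ge hle)).symm
  have key : ∀ ρ : ℝ, 0 < ρ → (∮ z in C(0, ρ), (z - 0)⁻¹ • G z) =
      Complex.I * ∫ θ in (0 : ℝ)..2 * π, G (circleMap 0 ρ θ) := by
    intro ρ hρ
    rw [circleIntegral, ← intervalIntegral.integral_const_mul]
    refine intervalIntegral.integral_congr fun θ _ => ?_
    have : circleMap 0 ρ θ ≠ 0 := circleMap_ne_center hρ.ne'
    simp only [deriv_circleMap, smul_eq_mul, sub_zero]
    field_simp
  have h := Complex.circleIntegral_sub_center_inv_smul_eq_of_differentiable_on_annulus_off_countable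
    (c := 0) (f := G) hr hle Set.countable_empty
    (fun z hz => (hG z (by
      rintro rfl
      exact hz.2 (Metric.mem_ball_self hr))).continuousAt.continuousWithinAt)
    (fun z hz => hG z (by
      rintro rfl
      exact hz.1.2 (Metric.mem_closedBall_self hr.le)))
  rw [key R hR, key r hr] at h
  exact mul_left_cancel₀ Complex.I_ne_zero h

open Real in
-- Multiplication by `p` scales by `‖p‖` and rotates by `p.arg`; periodicity absorbs the rotation.
theorem integral_circleMap_norm_mul (G : ℂ → ℂ) (p : ℂ) (R : ℝ) :
    ∫ θ in (0 : ℝ)..2 * π, G (circleMap 0 (‖p‖ * R) θ) =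
      ∫ θ in (0 : ℝ)..2 * π, G (p * circleMap 0 R θ) := by
  have e : ∀ θ : ℝ, p * circleMap 0 R θ = circleMap 0 (‖p‖ * R) (θ + p.arg) := by
    intro θ
    conv_lhs => rw [← Complex.norm_mul_exp_arg_mul_I p]
    simp only [circleMap_zero]
    push_cast
    rw [add_mul, Complex.exp_add]
    ring
  simp_rw [e]
  rw [intervalIntegral.integral_comp_add_right (fun θ => G (circleMap 0 (‖p‖ * R) θ))]
  have hper : Function.Periodic (fun θ => G (circleMap 0 (‖p‖ * R) θ)) (2 * π) :=
    (periodic_circleMap 0 (‖p‖ * R)).comp G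
  have := hper.intervalIntegral_add_eq 0 p.arg
  rw [zero_add] at this
  rw [this, zero_add, add_comm p.arg]

open Real in
-- The integrals are, up to powers of `R`, the Fourier coefficients of `h` on the circle. A
-- continuous function with summable Fourier coefficients is the pointwise sum of its Fourier
-- series.
theorem eq_zero_of_forall_integral_circleMap_eq_zero {h : ℂ → ℂ} {R : ℝ} (hR : 0 < R)
    (hh : ∀ z, z ≠ 0 → ContinuousAt h z)
    (h0 : ∀ n : ℤ, ∫ θ in (0 : ℝ)..2 * π, h (circleMap 0 R θ) * (circleMap 0 R θ) ^ n = 0)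
    {w : ℂ} (hw : ‖w‖ = R) : h w = 0 := by
  have : Fact (0 < 2 * π) := ⟨Real.two_pi_pos⟩
  have hne : ∀ x : AddCircle (2 * π), (R : ℂ) * fourier 1 x ≠ 0 := by
    intro x hx
    rcases mul_eq_zero.1 hx with hx | hx
    · exact hR.ne' (by exact_mod_cast hx)
    · rw [fourier_one] at hx
      exact Circle.coe_ne_zero _ hx
  let F : C(AddCircle (2 * π), ℂ) := ⟨fun x => h (R * fourier 1 x), by
    rw [continuous_iff_continuousAt]
    intro x
    exact ContinuousAt.comp (f := fun x : AddCircle (2 * π) => (R : ℂ) * fourier 1 x) (hh _ (hne x))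
      (by fun_prop)⟩
  have hmap : ∀ (n : ℤ) (θ : ℝ), (fourier n (θ : AddCircle (2 * π)) : ℂ) =
      (circleMap 0 R θ) ^ n * ((R : ℂ) ^ n)⁻¹ := by
    intro n θ
    rw [fourier_coe_apply, circleMap_zero, mul_zpow, ← Complex.exp_int_mul]
    have : ((R : ℂ) ^ n) ≠ 0 := zpow_ne_zero _ (by exact_mod_cast hR.ne')
    have hpi : (π : ℂ) ≠ 0 := by exact_mod_cast Real.pi_ne_zero
    field_simp
    congr 1
    push_cast
    field_simp
  have hc : ∀ n, fourierCoeff F n = 0 := by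
    intro n
    rw [fourierCoeff_eq_intervalIntegral _ _ 0, zero_add]
    have : ∀ θ : ℝ, (fourier (-n) (θ : AddCircle (2 * π)) : ℂ) • F θ =
        ((R : ℂ) ^ (-n))⁻¹ * (h (circleMap 0 R θ) * (circleMap 0 R θ) ^ (-n)) := by
      intro θ
      have e : (R : ℂ) * fourier 1 (θ : AddCircle (2 * π)) = circleMap 0 R θ := by
        rw [hmap, zpow_one, zpow_one]
        have : (R : ℂ) ≠ 0 := by exact_mod_cast hR.ne'
        field_simp
      change (fourier (-n) (θ : AddCircle (2 * π)) : ℂ) • h ((R : ℂ) * fourier 1 (θ : AddCircle (2 * π))) = _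
      rw [e, hmap, smul_eq_mul]
      ring
    simp_rw [this]
    rw [intervalIntegral.integral_const_mul, h0, mul_zero, smul_zero]
  have hs := has_pointwise_sum_fourier_series_of_summable (f := F)
    (by rw [show fourierCoeff F = fun _ => 0 from funext hc]; exact summable_zero) (w.arg : ℝ)
  simp only [hc, zero_smul] at hs
  have := hs.unique hasSum_zero
  change h ((R : ℂ) * fourier 1 ((w.arg : ℝ) : AddCircle (2 * π))) = 0 at this
  rwa [hmap, zpow_one, zpow_one, mul_comm, mul_assoc, inv_mul_cancel₀ (by exact_mod_cast hR.ne'), mul_one,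
    circleMap_zero, ← hw, Complex.norm_mul_exp_arg_mul_I] at this

open Real in
/-- A holomorphic function on `ℂ ∖ {0}` with `h (p z) = z⁻² h z` is determined by two of its
Laurent coefficients. -/
theorem eq_zero_of_quasiperiodic {h : ℂ → ℂ} {p : ℂ} (hp0 : p ≠ 0)
    (hh : ∀ z, z ≠ 0 → DifferentiableAt ℂ h z) (hq : ∀ z, z ≠ 0 → h (p * z) = h z / z ^ 2)
    (h0 : ∫ θ in (0 : ℝ)..2 * π, h (circleMap 0 1 θ) = 0)
    (h1 : ∫ θ in (0 : ℝ)..2 * π, h (circleMap 0 1 θ) * circleMap 0 1 θ = 0)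
    {w : ℂ} (hw : w ≠ 0) : h w = 0 := by
  have hd : ∀ n : ℤ, ∀ z, z ≠ 0 → DifferentiableAt ℂ (fun z => h z * z ^ n) z := fun n z hz =>
    (hh z hz).mul (differentiableAt_zpow.2 (Or.inl hz))
  -- Moving the contour to radius `‖p‖` and substituting `z ↦ p z` gives a recursion of step two
  -- between the moments.
  have step : ∀ n : ℤ, ∫ θ in (0 : ℝ)..2 * π, h (circleMap 0 1 θ) * circleMap 0 1 θ ^ n =
      p ^ n * ∫ θ in (0 : ℝ)..2 * π, h (circleMap 0 1 θ) * circleMap 0 1 θ ^ (n - 2) := by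
    intro n
    rw [integral_circleMap_eq_of_differentiableAt (hd n) (r := ‖p‖ * 1) (by simpa using hp0) one_pos,
      integral_circleMap_norm_mul (fun z => h z * z ^ n), ← intervalIntegral.integral_const_mul]
    refine intervalIntegral.integral_congr fun θ _ => ?_
    have hc : circleMap 0 1 θ ≠ 0 := circleMap_ne_center one_ne_zero
    rw [hq _ hc, mul_zpow, zpow_sub₀ hc]
    norm_cast
    field_simp
  -- The recursion runs upwards from the moments `0, 1` and, since `p ^ n ≠ 0`, also downwards; the
  -- pair `n`, `1 - n` covers all integers.
  have hz : ∀ n : ℕ, (∫ θ in (0 : ℝ)..2 * π, h (circleMap 0 1 θ) * circleMap 0 1 θ ^ (n : ℤ) = 0) ∧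
      ∫ θ in (0 : ℝ)..2 * π, h (circleMap 0 1 θ) * circleMap 0 1 θ ^ (1 - n : ℤ) = 0 := by
    intro n
    induction n using Nat.twoStepInduction with
    | zero => simpa using ⟨h0, h1⟩
    | one => simpa using ⟨h1, h0⟩
    | more n ih _ =>
      constructor
      · rw [step]
        push_cast
        rw [add_sub_cancel_right, ih.1, mul_zero]
      · have := step (1 - n)
        rw [ih.2] at this
        have := (mul_eq_zero.1 this.symm).resolve_left (zpow_ne_zero _ hp0)
        convert this using 5
        push_cast
        ring
  have hall : ∀ n : ℤ, ∫ θ in (0 : ℝ)..2 * π, h (circleMap 0 1 θ) * circleMap 0 1 θ ^ n = 0 := by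
    intro n
    rcases le_total 0 n with hn | hn
    · lift n to ℕ using hn
      exact (hz n).1
    · have := (hz (1 - n).toNat).2
      rw [Int.toNat_of_nonneg (by omega)] at this
      simpa using this
  refine eq_zero_of_forall_integral_circleMap_eq_zero (norm_pos_iff.2 hw)
    (fun z hz => (hh z hz).continuousAt) (fun n => ?_) rfl
  rw [integral_circleMap_eq_of_differentiableAt (hd n) (r := 1) one_pos (norm_pos_iff.2 hw), hall]

/-! ### The Weierstrass three-term relation -/

/-- The antisymmetric kernel `x⁻¹ θ(x y) θ(x / y)`. -/
noncomputable def thetaKernel (p x y : ℂ) : ℂ :=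
  ellTheta (x * y) p * ellTheta (x / y) p / x

theorem thetaKernel_antisymm {p x y : ℂ} (hp : ‖p‖ < 1) (hx : x ≠ 0) (hy : y ≠ 0) :
    thetaKernel p y x = -thetaKernel p x y := by
  unfold thetaKernel
  rw [ellTheta_div_comm hp hx hy, mul_comm y x]
  field_simp

/-- The functions `w ↦ θ(w y_j) θ(w / y_j)` share the multiplier `z⁻²`, so two moments determine any
combination of them. Four coefficients against two linear conditions leave a nontrivial kernel. -/
theorem exists_ne_zero_sum_thetaKernel_eq_zero {p : ℂ} (hp : ‖p‖ < 1) (hp0 : p ≠ 0) (y : Fin 4 → ℂ)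
    (hy : ∀ i, y i ≠ 0) :
    ∃ v : Fin 4 → ℂ, v ≠ 0 ∧ ∀ w, w ≠ 0 → ∑ j, v j * thetaKernel p w (y j) = 0 := by
  let h : Fin 4 → ℂ → ℂ := fun j z => ellTheta (z * y j) p * ellTheta (z / y j) p
  have hd : ∀ j z, z ≠ 0 → DifferentiableAt ℂ (h j) z := fun j z hz =>
    ((differentiableAt_ellTheta hp (mul_ne_zero hz (hy j))).comp (f := fun z => z * y j) z
      (by fun_prop)).mul
      ((differentiableAt_ellTheta hp (div_ne_zero hz (hy j))).comp (f := fun z => z / y j) z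
        (by fun_prop))
  have hq : ∀ j z, z ≠ 0 → h j (p * z) = h j z / z ^ 2 := by
    intro j z hz
    have := hy j
    simp only [h]
    rw [mul_assoc, mul_div_assoc, ellTheta_mul_self hp hp0 (by positivity),
      ellTheta_mul_self hp hp0 (by positivity)]
    field_simp
  let m : ℕ → Fin 4 → ℂ := fun i j =>
    ∫ θ in (0 : ℝ)..2 * Real.pi, h j (circleMap 0 1 θ) * circleMap 0 1 θ ^ i
  let L : (Fin 4 → ℂ) →ₗ[ℂ] (Fin 2 → ℂ) := Matrix.toLin' (Matrix.of fun i j => m i j)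
  obtain ⟨v, hv, hv0⟩ := (Submodule.ne_bot_iff _).1
    (L.ker_ne_bot_of_finrank_lt (by simp))
  refine ⟨v, hv0, fun w hw => ?_⟩
  have hm : ∀ i : Fin 2, ∑ j, v j * m i j = 0 := by
    intro i
    have := congrFun (LinearMap.mem_ker.1 hv) i
    simp only [L, Matrix.toLin'_apply, Matrix.mulVec, dotProduct, Matrix.of_apply] at this
    simpa only [mul_comm, Pi.zero_apply] using this
  have hint : ∀ i : ℕ, ∫ θ in (0 : ℝ)..2 * Real.pi,
      (∑ j, v j * h j (circleMap 0 1 θ)) * circleMap 0 1 θ ^ i = ∑ j, v j * m i j := by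
    intro i
    simp only [Finset.sum_mul, m, mul_assoc]
    rw [intervalIntegral.integral_finsetSum]
    · simp_rw [intervalIntegral.integral_const_mul]
    · intro j _
      refine (Continuous.intervalIntegrable ?_ _ _)
      refine continuous_const.mul (Continuous.mul ?_ (by fun_prop))
      rw [continuous_iff_continuousAt]
      intro θ
      exact ContinuousAt.comp (f := fun θ => circleMap 0 1 θ)
        (hd j _ (circleMap_ne_center one_ne_zero)).continuousAt (by fun_prop)
  have h0 := eq_zero_of_quasiperiodic (h := fun z => ∑ j, v j * h j z) hp0
    (fun z hz => DifferentiableAt.fun_sum fun j _ => (hd j z hz).const_mul _)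
    (fun z hz => by
      rw [Finset.sum_div]
      exact Finset.sum_congr rfl fun j _ => by rw [hq j z hz]; ring)
    (by simpa [hm 0] using (hint 0).trans (hm 0)) (by simpa using (hint 1).trans (hm 1)) hw
  have e : ∑ j, v j * thetaKernel p w (y j) = (∑ j, v j * h j w) / w := by
    rw [Finset.sum_div]
    exact Finset.sum_congr rfl fun j _ => by simp only [thetaKernel, h]; ring
  rw [e, h0, zero_div]

/-- The Weierstrass three-term identity for theta functions. -/
theorem thetaKernel_three_term {p x y u v : ℂ} (hp : ‖p‖ < 1) (hx : x ≠ 0) (hy : y ≠ 0) (hu : u ≠ 0)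
    (hv : v ≠ 0) :
    thetaKernel p x y * thetaKernel p u v - thetaKernel p x u * thetaKernel p y v +
      thetaKernel p x v * thetaKernel p y u = 0 := by
  -- Quasi-periodicity is lost at `p = 0`, where `θ(z) = 1 - z` and the relation is elementary
  -- algebra.
  by_cases hp0 : p = 0
  · subst hp0
    have : ∀ z, ellTheta z 0 = 1 - z := fun z => by
      have h1 : pochInf 0 0 = 1 := by simp [pochInf]
      rw [ellTheta, zero_div, pochInf_eq_mul z (by simp), mul_zero, h1]
      ring
    simp only [thetaKernel, this]
    field_simp
    ring
  let z : Fin 4 → ℂ := ![x, y, u, v]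
  have hz : ∀ i, z i ≠ 0 := by
    intro i
    fin_cases i <;> assumption
  obtain ⟨c, hc0, hc⟩ := exists_ne_zero_sum_thetaKernel_eq_zero hp hp0 z hz
  let M : Matrix (Fin 4) (Fin 4) ℂ := fun i j => thetaKernel p (z i) (z j)
  -- The dependency among the four functions, evaluated at the four points themselves, is a kernel
  -- vector.
  have hdet : M.det = 0 := by
    refine Matrix.exists_mulVec_eq_zero_iff.1 ⟨c, hc0, funext fun i => ?_⟩
    simpa [Matrix.mulVec, dotProduct, M, mul_comm] using hc (z i) (hz i)
  have hself : ∀ {w : ℂ}, w ≠ 0 → thetaKernel p w w = 0 := fun hw => by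
    simp [thetaKernel, div_self hw, ellTheta_one hp]
  have hM : M = !![0, thetaKernel p x y, thetaKernel p x u, thetaKernel p x v;
      -thetaKernel p x y, 0, thetaKernel p y u, thetaKernel p y v;
      -thetaKernel p x u, -thetaKernel p y u, 0, thetaKernel p u v;
      -thetaKernel p x v, -thetaKernel p y v, -thetaKernel p u v, 0] := by
    rw [← thetaKernel_antisymm hp hx hy, ← thetaKernel_antisymm hp hx hu,
      ← thetaKernel_antisymm hp hx hv, ← thetaKernel_antisymm hp hy hu,
      ← thetaKernel_antisymm hp hy hv, ← thetaKernel_antisymm hp hu hv]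
    ext i j
    fin_cases i <;> fin_cases j <;> simp [M, z, hself, hx, hy, hu, hv]
  rw [hM] at hdet
  -- The determinant of an antisymmetric `4 × 4` matrix is the square of its Pfaffian, and this
  -- Pfaffian is the three-term expression.
  refine pow_eq_zero_iff (two_ne_zero) |>.1 (hdet ▸ ?_)
  simp [Matrix.det_succ_row_zero, Fin.sum_univ_succ, Fin.succAbove]
  ring

/-- The pairs `(a, b)`, `(c, d)`, `(e, f)` have a common product `m²`. The kernel relation at `t m`,
`a / m`, `c / m`, `e / m` then takes this form, free of square roots. -/
theorem ellTheta_three_term {p t a b c d e f : ℂ} (hp : ‖p‖ < 1) (ht : t ≠ 0) (ha : a ≠ 0) (hb : b ≠ 0)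
    (hc : c ≠ 0) (he : e ≠ 0) (hcd : c * d = a * b) (hef : e * f = a * b) :
    ellTheta (t * a) p * ellTheta (t * b) p * ellTheta (c / f) p * ellTheta (c / e) p / c -
      ellTheta (t * c) p * ellTheta (t * d) p * ellTheta (a / e) p * ellTheta (a / f) p / a +
      ellTheta (t * e) p * ellTheta (t * f) p * ellTheta (a / c) p * ellTheta (a / d) p / a = 0 := by
  obtain ⟨m, hm⟩ := IsAlgClosed.exists_pow_nat_eq (a * b) two_pos
  have hm0 : m ≠ 0 := by
    rintro rfl
    exact mul_ne_zero ha hb (by simpa using hm.symm)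
  have hdd : d = m ^ 2 / c := by rw [hm]; field_simp; linear_combination hcd
  have hff : f = m ^ 2 / e := by rw [hm]; field_simp; linear_combination hef
  have hbb : b = m ^ 2 / a := by rw [hm]; field_simp
  have h := thetaKernel_three_term (p := p) hp (x := t * m) (y := a / m) (u := c / m) (v := e / m)
    (by positivity) (by positivity) (by positivity) (by positivity)
  have e1 : ∀ z : ℂ, z ≠ 0 → thetaKernel p (t * m) (z / m) =
      ellTheta (t * z) p * ellTheta (t * (m ^ 2 / z)) p / (t * m) := fun z hz => by
    rw [thetaKernel, show t * m * (z / m) = t * z by field_simp,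
      show t * m / (z / m) = t * (m ^ 2 / z) by field_simp]
  have e2 : ∀ z w : ℂ, z ≠ 0 → w ≠ 0 → thetaKernel p (z / m) (w / m) =
      ellTheta (z / (m ^ 2 / w)) p * ellTheta (z / w) p / (z / m) := fun z w hz hw => by
    rw [thetaKernel, show z / m * (w / m) = z / (m ^ 2 / w) by field_simp,
      show z / m / (w / m) = z / w by field_simp]
  rw [e1 a ha, e1 c hc, e1 e he, e2 c e hc he, e2 a e ha he, e2 a c ha hc, ← hbb, ← hdd, ← hff] at h
  field_simp at h ⊢
  linear_combination h

/-! ### Partial fraction identities of types D and A -/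

/-- Lagrange interpolation, in homogeneous form, for an antisymmetric kernel of rank two. -/
theorem sum_prod_antisymm_kernel {α ι K : Type*} [Field K] [DecidableEq ι] (f : α → α → K)
    (hf : ∀ a b, f b a = -f a b)
    (hpl : ∀ a b c d, f a b * f c d - f a c * f b d + f a d * f b c = 0)
    (S : Finset ι) (X : ι → α) (hX : ∀ r ∈ S, ∀ s ∈ S, r ≠ s → f (X r) (X s) ≠ 0) (Y : Multiset α)
    (hY : Y.card + 1 = S.card) (G : α) :
    ∑ r ∈ S, (Y.map (f (X r))).prod * ∏ s ∈ S.erase r, f G (X s) / f (X r) (X s) =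
      (Y.map (f G)).prod := by
  induction S using Finset.induction generalizing Y G with
  | empty => simp at hY
  | insert i S hi ih =>
    rw [Finset.card_insert_of_notMem hi, add_left_inj] at hY
    rcases Y.empty_or_exists_mem with rfl | ⟨y, hy⟩
    · have : S = ∅ := by simpa [eq_comm] using hY
      simp [this]
    obtain ⟨Z, rfl⟩ := Multiset.exists_cons_of_mem hy
    have hZ : Z.card + 1 = S.card := by simpa using hY
    have hX' : ∀ r ∈ S, ∀ s ∈ S, r ≠ s → f (X r) (X s) ≠ 0 := fun r hr s hs =>
      hX r (Finset.mem_insert_of_mem hr) s (Finset.mem_insert_of_mem hs)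
    have hir : ∀ r ∈ S, f (X i) (X r) ≠ 0 ∧ f (X r) (X i) ≠ 0 := fun r hr => by
      have : i ≠ r := by rintro rfl; exact hi hr
      exact ⟨hX i (by simp) r (by simp [hr]) this, hX r (by simp [hr]) i (by simp) this.symm⟩
    -- With `y` removed, the smaller identity is used at `G` and at the new node `X i`; the latter
    -- rewrites the term of index `i` as a sum over `S`.
    have h1 := ih hX' Z hZ (X i)
    have h2 := ih hX' Z hZ G
    simp only [Multiset.map_cons, Multiset.prod_cons]
    rw [← h2, Finset.sum_insert hi, Finset.erase_insert hi, ← h1, Finset.mul_sum, Finset.sum_mul,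
      Finset.mul_sum, ← Finset.sum_add_distrib]
    refine Finset.sum_congr rfl fun r hr => ?_
    have hri : i ≠ r := by rintro rfl; exact hi hr
    rw [Finset.erase_insert_of_ne hri, Finset.prod_insert (by simp [hi]),
      ← Finset.mul_prod_erase S _ hr]
    have e : ∏ s ∈ S.erase r, f G (X s) / f (X r) (X s) =
        (∏ s ∈ S.erase r, f (X i) (X s) / f (X r) (X s)) *
          ∏ s ∈ S.erase r, f G (X s) / f (X i) (X s) := by
      rw [← Finset.prod_mul_distrib]
      refine Finset.prod_congr rfl fun s hs => ?_
      have := hir s (Finset.mem_of_mem_erase hs)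
      have := this.1
      field_simp
    rw [e]
    -- Two-point interpolation at `X i` and `X r`: this is the three-term relation divided by `f (X
    -- i) (X r)`.
    have e2 : f G y = f G (X r) / f (X i) (X r) * f (X i) y + f G (X i) / f (X r) (X i) * f (X r) y := by
      have := (hir r hr).1
      have := (hir r hr).2
      rw [hf (X i) (X r)] at this ⊢
      field_simp
      linear_combination hpl G y (X i) (X r) + f G (X i) * hf y (X r) - f G (X r) * hf y (X i)
    rw [e2]
    ring

/-- The partial fraction identity of type `D`. -/
theorem sum_partial_fraction_D {n : ℕ} (hn : 1 ≤ n) {p G : ℂ} (hp : ‖p‖ < 1) (hG : G ≠ 0)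
    (X : Fin n → ℂ) (y : Fin (n - 1) → ℂ) (hX0 : ∀ r, X r ≠ 0) (hy0 : ∀ s, y s ≠ 0)
    (hX : ∀ r s, r ≠ s → ellTheta (X r * X s) p ≠ 0 ∧ ellTheta (X r / X s) p ≠ 0)
    (hGy : ∀ s, ellTheta (G * y s) p ≠ 0 ∧ ellTheta (G / y s) p ≠ 0) :
    ∑ r, (∏ s, ellTheta (X r * y s) p * ellTheta (X r / y s) p /
        (ellTheta (G * y s) p * ellTheta (G / y s) p)) *
      ∏ s ∈ Finset.univ.erase r, ellTheta (G * X s) p * ellTheta (G / X s) p /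
        (ellTheta (X r * X s) p * ellTheta (X r / X s) p) = 1 := by
  -- On units, antisymmetry and the three-term relation hold without side conditions.
  let f : ℂˣ → ℂˣ → ℂ := fun a b => thetaKernel p a b
  have h := sum_prod_antisymm_kernel f (fun a b => thetaKernel_antisymm hp a.ne_zero b.ne_zero)
    (fun a b c d => thetaKernel_three_term hp a.ne_zero b.ne_zero c.ne_zero d.ne_zero)
    Finset.univ (fun r => Units.mk0 (X r) (hX0 r)) (fun r _ s _ hrs => by
      simp only [f, thetaKernel, Units.val_mk0]
      exact div_ne_zero (mul_ne_zero (hX r s hrs).1 (hX r s hrs).2) (hX0 r))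
    (Finset.univ.val.map fun s => Units.mk0 (y s) (hy0 s)) (by simp; omega) (Units.mk0 G hG)
  simp only [Multiset.map_map, Function.comp_def, f, Units.val_mk0] at h
  change ∑ r, (∏ s, thetaKernel p (X r) (y s)) * _ = ∏ s, thetaKernel p G (y s) at h
  have hne : ∏ s, thetaKernel p G (y s) ≠ 0 := Finset.prod_ne_zero_iff.2 fun s _ =>
    div_ne_zero (mul_ne_zero (hGy s).1 (hGy s).2) hG
  rw [← div_eq_one_iff_eq hne, Finset.sum_div] at h
  rw [← h]
  refine Finset.sum_congr rfl fun r _ => ?_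
  rw [mul_div_right_comm, ← Finset.prod_div_distrib]
  have e1 : ∀ s, thetaKernel p (X r) (y s) / thetaKernel p G (y s) =
      ellTheta (X r * y s) p * ellTheta (X r / y s) p /
        (ellTheta (G * y s) p * ellTheta (G / y s) p) * (G / X r) := fun s => by
    have := (hGy s).1
    have := (hGy s).2
    have := hX0 r
    simp only [thetaKernel]
    field_simp
  have e2 : ∀ s ∈ Finset.univ.erase r, thetaKernel p G (X s) / thetaKernel p (X r) (X s) =
      ellTheta (G * X s) p * ellTheta (G / X s) p /
        (ellTheta (X r * X s) p * ellTheta (X r / X s) p) * (X r / G) := fun s hs => by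
    have hrs := hX r s (Finset.ne_of_mem_erase hs).symm
    have := hrs.1
    have := hrs.2
    have := hX0 r
    simp only [thetaKernel]
    field_simp
  rw [Finset.prod_congr rfl fun s _ => e1 s, Finset.prod_congr rfl e2, Finset.prod_mul_distrib,
    Finset.prod_mul_distrib]
  simp only [Finset.prod_const, Finset.card_univ, Fintype.card_fin,
    Finset.card_erase_of_mem (Finset.mem_univ r)]
  -- The prefactors of the kernels cancel because there are as many `y s` as nodes other than `X r`.
  have : (G / X r) ^ (n - 1) * (X r / G) ^ (n - 1) = 1 := by
    rw [← mul_pow, div_mul_div_cancel₀ (hX0 r), div_self hG, one_pow]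
  linear_combination (-((∏ s, ellTheta (X r * y s) p * ellTheta (X r / y s) p /
        (ellTheta (G * y s) p * ellTheta (G / y s) p)) *
      ∏ s ∈ Finset.univ.erase r, ellTheta (G * X s) p * ellTheta (G / X s) p /
        (ellTheta (X r * X s) p * ellTheta (X r / X s) p))) * this

/-- Interpolation of the theta function `t ↦ ∏ θ(t x_s)` at the nodes `t = (x_s q^{k_s})⁻¹`. -/
theorem sum_partial_fraction_A {ι : Type*} [DecidableEq ι] {p q : ℂ} (hp : ‖p‖ < 1) (hq0 : q ≠ 0)
    (S : Finset ι) (x X : ι → ℂ) (k : ι → ℕ) (hx : ∀ s, x s ≠ 0) (hXx : ∀ s, X s = x s * q ^ k s)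
    (hX : ∀ r ∈ S, ∀ s ∈ S, r ≠ s → ellTheta (X r / X s) p ≠ 0)
    (hq : ∀ j, 1 ≤ j → j ≤ ∑ s ∈ S, k s → ellTheta (q ^ j) p ≠ 0) {t : ℂ} (ht : t ≠ 0) :
    ∑ r ∈ S, ellTheta (t * (X r / q ^ ∑ s ∈ S, k s)) p * (∏ s ∈ S, ellTheta (X r / x s) p) *
        ∏ s ∈ S.erase r, ellTheta (t * X s) p / ellTheta (X r / X s) p =
      ellTheta (q ^ ∑ s ∈ S, k s) p * ∏ s ∈ S, ellTheta (t * x s) p := by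
  have hX0 : ∀ s, X s ≠ 0 := fun s => by
    rw [hXx]
    exact mul_ne_zero (hx s) (pow_ne_zero _ hq0)
  induction S using Finset.induction generalizing t with
  | empty => simp [ellTheta_one hp]
  | insert i S hi ih =>
    have hX' : ∀ r ∈ S, ∀ s ∈ S, r ≠ s → ellTheta (X r / X s) p ≠ 0 := fun r hr s hs =>
      hX r (Finset.mem_insert_of_mem hr) s (Finset.mem_insert_of_mem hs)
    have hri : ∀ r ∈ S, i ≠ r := fun r hr => by rintro rfl; exact hi hr
    have hir : ∀ r ∈ S, ellTheta (X i / X r) p ≠ 0 ∧ ellTheta (X r / X i) p ≠ 0 := fun r hr =>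
      ⟨hX i (by simp) r (by simp [hr]) (hri r hr), hX r (by simp [hr]) i (by simp) (hri r hr).symm⟩
    rw [Finset.sum_insert hi, Finset.erase_insert hi, Finset.sum_insert hi, Finset.prod_insert hi,
      Finset.prod_insert hi]
    -- If the `k s` vanish on `S`, the smaller identity carries the factor `θ(1) = 0` and is
    -- useless; but then `X s = x s` and only the term of index `i` survives. Otherwise that factor,
    -- `θ(Λ)`, can be cancelled.
    by_cases hk : ∑ s ∈ S, k s = 0
    · have hXs : ∀ s ∈ S, X s = x s := fun s hs => by
        rw [hXx, Finset.sum_eq_zero_iff.1 hk s hs, pow_zero, mul_one]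
      rw [hk, add_zero, Finset.sum_eq_zero (s := S), add_zero]
      · have e1 : X i / q ^ k i = x i := by rw [hXx]; field_simp
        have e2 : X i / x i = q ^ k i := by
          have := hx i
          rw [hXx]; field_simp
        rw [e1, e2, mul_assoc, mul_assoc, ← Finset.prod_mul_distrib, mul_left_comm]
        congr 2
        refine Finset.prod_congr rfl fun s hs => ?_
        have := (hir s hs).1
        rw [← hXs s hs]
        field_simp
      · intro r hr
        rw [Finset.prod_insert hi, Finset.prod_eq_zero hr (by
          rw [hXs r hr, div_self (hx r), ellTheta_one hp])]
        simp
    · have hΛ' : ellTheta (q ^ ∑ s ∈ S, k s) p ≠ 0 := hq _ (Nat.one_le_iff_ne_zero.2 hk) (by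
        rw [Finset.sum_insert hi]; omega)
      have IH := fun {t : ℂ} (ht : t ≠ 0) => ih hX' (fun j h1 h2 => hq j h1 (by
        rw [Finset.sum_insert hi]; omega)) ht
      have hprod : ∏ s ∈ S, X s / x s = q ^ ∑ s ∈ S, k s := by
        rw [← Finset.prod_pow_eq_pow_sum]
        refine Finset.prod_congr rfl fun s _ => ?_
        have := hx s
        rw [hXx]; field_simp
      have hΛ : q ^ (k i + ∑ s ∈ S, k s) = q ^ (∑ s ∈ S, k s) * (X i / x i) := by
        have := hx i
        rw [hXx, pow_add]; field_simp
      have hΛ0 : q ^ (∑ s ∈ S, k s) ≠ 0 := pow_ne_zero _ hq0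
      rw [hΛ]
      generalize q ^ (∑ s ∈ S, k s) = Λ at *
      set L := Λ * (X i / x i) with hL
      have hxi := hx i
      have hXi := hX0 i
      have hL0 : L ≠ 0 := by positivity
      -- The three-term relation writes the `r`-th term of the smaller identity at `t` through the
      -- `r`-th term of the larger one and the `r`-th term of the smaller one at `t = (X i)⁻¹`.
      -- Summed over `r`, the last part produces the missing term of index `i`.
      have key : ∀ r ∈ S, ellTheta (t * (X r / Λ)) p * ellTheta (t * x i) p * ellTheta L p =
          (ellTheta (t * (X r / L)) p * ellTheta (t * X i) p * ellTheta (X r / x i) p *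
              ellTheta Λ p +
            Λ * (ellTheta (t * (X i / L)) p * ellTheta (t * X r) p * ellTheta (X i / x i) p *
              ellTheta ((X i)⁻¹ * (X r / Λ)) p)) / ellTheta (X r / X i) p := by
        intro r hr
        have hXr := hX0 r
        rw [eq_div_iff (hir r hr).2]
        have h := ellTheta_three_term (p := p) (t := t) (a := X r / Λ) (b := x i) (c := X r / L)
          (d := X i) (e := X i / L) (f := X r) hp ht (by positivity) hxi (by positivity)
          (by positivity) (by rw [hL]; field_simp) (by rw [hL]; field_simp)
        rw [show X r / L / X r = L⁻¹ by field_simp, show X r / L / (X i / L) = X r / X i by field_simp,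
          show X r / Λ / (X i / L) = X r / x i by rw [hL]; field_simp,
          show X r / Λ / X r = Λ⁻¹ by field_simp,
          show X r / Λ / (X r / L) = X i / x i by rw [hL]; field_simp,
          show X r / Λ / X i = (X i)⁻¹ * (X r / Λ) by field_simp,
          ellTheta_inv hp hL0, ellTheta_inv hp hΛ0] at h
        field_simp at h
        rw [mul_div_assoc', mul_div_assoc', mul_div_assoc', inv_mul_eq_div, div_div]
        linear_combination -h
      have hswap : ∀ s ∈ S, ellTheta ((X i)⁻¹ * X s) p ≠ 0 := fun s hs => by
        rw [inv_mul_eq_div]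
        exact (hir s hs).2
      have hE : ∀ r ∈ S, ellTheta (t * X r) p *
          (∏ s ∈ S.erase r, ellTheta (t * X s) p / ellTheta (X r / X s) p) / ellTheta (X r / X i) p =
          (∏ s ∈ S, ellTheta (t * X s) p / ellTheta ((X i)⁻¹ * X s) p) *
            ∏ s ∈ S.erase r, ellTheta ((X i)⁻¹ * X s) p / ellTheta (X r / X s) p := by
        intro r hr
        rw [← Finset.mul_prod_erase S _ hr, mul_assoc, ← Finset.prod_mul_distrib, inv_mul_eq_div,
          mul_div_right_comm]
        congr 1
        refine Finset.prod_congr rfl fun s hs => ?_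
        exact (div_mul_div_cancel₀ (hswap s (Finset.mem_of_mem_erase hs))).symm
      have hfin : Λ * ((∏ s ∈ S, ellTheta (t * X s) p / ellTheta ((X i)⁻¹ * X s) p) *
          ∏ s ∈ S, ellTheta ((X i)⁻¹ * x s) p) =
          (∏ s ∈ S, ellTheta (X i / x s) p) *
            ∏ s ∈ S, ellTheta (t * X s) p / ellTheta (X i / X s) p := by
        rw [← hprod, ← Finset.prod_mul_distrib, ← Finset.prod_mul_distrib,
          ← Finset.prod_mul_distrib]
        refine Finset.prod_congr rfl fun s hs => ?_
        have h1 := hx s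
        have h2 := hX0 s
        have h3 := (hir s hs).1
        rw [inv_mul_eq_div, inv_mul_eq_div, ellTheta_div_comm hp hXi h1, ellTheta_div_comm hp hXi h2]
        field_simp
      refine mul_left_cancel₀ hΛ' ?_
      have h1 := IH ht
      have h2 := IH (inv_ne_zero hXi)
      calc _ = ∑ r ∈ S, (ellTheta (t * (X r / L)) p * ellTheta (t * X i) p * ellTheta (X r / x i) p *
              ellTheta Λ p) / ellTheta (X r / X i) p * ((∏ s ∈ S, ellTheta (X r / x s) p) *
              ∏ s ∈ S.erase r, ellTheta (t * X s) p / ellTheta (X r / X s) p) +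
            Λ * ((∏ s ∈ S, ellTheta (t * X s) p / ellTheta ((X i)⁻¹ * X s) p) *
              (ellTheta Λ p * ∏ s ∈ S, ellTheta ((X i)⁻¹ * x s) p)) *
              (ellTheta (t * (X i / L)) p * ellTheta (X i / x i) p) := by
            rw [mul_add, add_comm, Finset.mul_sum]
            congr 1
            · refine Finset.sum_congr rfl fun r hr => ?_
              rw [Finset.prod_insert hi, Finset.erase_insert_of_ne (hri r hr),
                Finset.prod_insert (by simp [hi])]
              ring
            · linear_combination -(ellTheta Λ p * (ellTheta (t * (X i / L)) p *
                ellTheta (X i / x i) p)) * hfin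
        _ = ∑ r ∈ S, ellTheta (t * (X r / Λ)) p * ellTheta (t * x i) p * ellTheta L p *
              ((∏ s ∈ S, ellTheta (X r / x s) p) *
              ∏ s ∈ S.erase r, ellTheta (t * X s) p / ellTheta (X r / X s) p) := by
            rw [← h2, Finset.mul_sum, Finset.mul_sum, Finset.sum_mul, ← Finset.sum_add_distrib]
            refine Finset.sum_congr rfl fun r hr => ?_
            rw [key r hr]
            linear_combination -(Λ * (ellTheta (t * (X i / L)) p * ellTheta (X i / x i) p) *
              ellTheta ((X i)⁻¹ * (X r / Λ)) p * ∏ s ∈ S, ellTheta (X r / x s) p) * hE r hr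
        _ = _ := by
            rw [mul_left_comm, mul_left_comm (ellTheta Λ p), ← h1, Finset.mul_sum, Finset.mul_sum]
            refine Finset.sum_congr rfl fun r _ => ?_
            ring

/-! ### Shifted factorials and the effect of raising one coordinate -/

theorem ellFac_zero (a q p : ℂ) : ellFac a q p 0 = 1 := by simp [ellFac]

theorem ellFac_succ (a q p : ℂ) (k : ℕ) :
    ellFac a q p (k + 1) = ellFac a q p k * ellTheta (a * q ^ k) p := by
  rw [ellFac, Finset.prod_range_succ, ellFac]

theorem ellFac_ne_zero_iff {a q p : ℂ} {N : ℕ} :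
    ellFac a q p N ≠ 0 ↔ ∀ j < N, ellTheta (a * q ^ j) p ≠ 0 := by
  simp [ellFac, Finset.prod_ne_zero_iff]

theorem ellFac_ne_zero_of_le {a q p : ℂ} {k N : ℕ} (h : ellFac a q p N ≠ 0) (hk : k ≤ N) :
    ellFac a q p k ≠ 0 :=
  ellFac_ne_zero_iff.2 fun j hj => ellFac_ne_zero_iff.1 h j (hj.trans_le hk)

theorem ellFacs_cons (a : ℂ) (as : List ℂ) (q p : ℂ) (k : ℕ) :
    ellFacs (a :: as) q p k = ellFac a q p k * ellFacs as q p k := by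
  simp [ellFacs]

theorem ellFacs_nil (q p : ℂ) (k : ℕ) : ellFacs [] q p k = 1 := by
  simp [ellFacs]

/-- Only the pairs containing `i` change, and each other index lies in exactly one of them. -/
theorem prod_Ioi_mul_of_row_col {n : ℕ} {M : Type*} [CommMonoid M] (F F' : Fin n → Fin n → M)
    (ρ : Fin n → M) (i : Fin n) (h : ∀ r s, r < s → r ≠ i → s ≠ i → F' r s = F r s)
    (h1 : ∀ s, i < s → F' i s = F i s * ρ s) (h2 : ∀ r, r < i → F' r i = F r i * ρ r) :
    ∏ r, ∏ s ∈ Finset.Ioi r, F' r s =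
      (∏ r, ∏ s ∈ Finset.Ioi r, F r s) * ∏ s ∈ Finset.univ.erase i, ρ s := by
  have e : ∀ r, ∏ s ∈ Finset.Ioi r, F' r s = (∏ s ∈ Finset.Ioi r, F r s) *
      if r = i then ∏ s ∈ Finset.Ioi i, ρ s else if r < i then ρ r else 1 := by
    intro r
    split_ifs with hr hr'
    · subst hr
      rw [← Finset.prod_mul_distrib]
      exact Finset.prod_congr rfl fun s hs => h1 s (Finset.mem_Ioi.1 hs)
    · rw [← Finset.mul_prod_erase _ _ (Finset.mem_Ioi.2 hr'),
        ← Finset.mul_prod_erase _ (F r) (Finset.mem_Ioi.2 hr'), h2 r hr', mul_right_comm]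
      congr 2
      exact Finset.prod_congr rfl fun s hs =>
        h r s (Finset.mem_Ioi.1 (Finset.mem_of_mem_erase hs)) hr (Finset.ne_of_mem_erase hs)
    · rw [mul_one]
      refine Finset.prod_congr rfl fun s hs => h r s (Finset.mem_Ioi.1 hs) hr ?_
      rintro rfl
      exact hr' (Finset.mem_Ioi.1 hs)
  rw [Finset.prod_congr rfl fun r _ => e r, Finset.prod_mul_distrib]
  congr 1
  rw [← Finset.mul_prod_erase _ _ (Finset.mem_univ i), if_pos rfl]
  have e2 : ∏ s ∈ Finset.Ioi i, ρ s = ∏ s ∈ Finset.univ.erase i, if i < s then ρ s else 1 := by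
    rw [← Finset.prod_filter]
    refine Finset.prod_congr ?_ fun _ _ => rfl
    ext s
    simp only [Finset.mem_Ioi, Finset.mem_filter, Finset.mem_erase, Finset.mem_univ, and_true]
    exact ⟨fun h => ⟨h.ne', h⟩, fun h => h.2⟩
  rw [e2, ← Finset.prod_mul_distrib]
  refine Finset.prod_congr rfl fun s hs => ?_
  have hs := Finset.ne_of_mem_erase hs
  rw [if_neg hs]
  rcases lt_or_gt_of_ne hs with hlt | hlt
  · simp [hlt, hlt.not_gt]
  · simp [hlt, hlt.not_gt]

section Step

variable {n : ℕ} {q p g : ℂ} {x X : Fin n → ℂ} {k : Fin n → ℕ}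

theorem sum_update_succ (k : Fin n → ℕ) (i : Fin n) :
    ∑ r, Function.update k i (k i + 1) r = ∑ r, k r + 1 := by
  rw [Finset.sum_update_of_mem (Finset.mem_univ i), ← Finset.add_sum_erase _ _ (Finset.mem_univ i),
    Finset.sdiff_singleton_eq_erase]
  omega

/-- For `r < i` the raised coordinate sits in the denominator. Inverting the theta functions gives
these pairs the shape of the pairs `(i, s)` at a cost of `q⁻¹` each, which the factor `q ^ ∑ r, r *
k r` repays: it grows by `q ^ i`. -/
theorem dnFactor_pairs_update (hp : ‖p‖ < 1) (hq : q ≠ 0) (hx : ∀ r, x r ≠ 0)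
    (hX : ∀ r, X r = x r * q ^ k r) (hXX : ∀ r s, r ≠ s → ellTheta (X r / X s) p ≠ 0) (i : Fin n) :
    (∏ r, ∏ s ∈ Finset.Ioi r, ellTheta (q ^ ((Function.update k i (k i + 1) r : ℤ) -
          (Function.update k i (k i + 1) s : ℤ)) * x r / x s) p / (ellTheta (x r / x s) p *
          ellFac (x r * x s) q p (Function.update k i (k i + 1) r + Function.update k i (k i + 1) s))) *
        q ^ (∑ r : Fin n, (r : ℕ) * Function.update k i (k i + 1) r) =
      ((∏ r, ∏ s ∈ Finset.Ioi r, ellTheta (q ^ ((k r : ℤ) - (k s : ℤ)) * x r / x s) p /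
          (ellTheta (x r / x s) p * ellFac (x r * x s) q p (k r + k s))) *
        q ^ (∑ r : Fin n, (r : ℕ) * k r)) *
        ∏ s ∈ Finset.univ.erase i,
          ellTheta (q * X i / X s) p / (ellTheta (X i / X s) p * ellTheta (X i * X s) p) := by
  have hX0 : ∀ r, X r ≠ 0 := fun r => by
    rw [hX]
    exact mul_ne_zero (hx r) (pow_ne_zero _ hq)
  have hdiv : ∀ r s, q ^ ((k r : ℤ) - (k s : ℤ)) * x r / x s = X r / X s := fun r s => by
    have := hx s
    rw [hX, hX, zpow_sub₀ hq, zpow_natCast, zpow_natCast]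
    field_simp
  have hfac : ∀ r s, ellFac (x r * x s) q p (k r + k s + 1) =
      ellFac (x r * x s) q p (k r + k s) * ellTheta (X r * X s) p := fun r s => by
    rw [ellFac_succ, hX, hX]
    congr 2
    ring
  rw [prod_Ioi_mul_of_row_col (fun r s => ellTheta (q ^ ((k r : ℤ) - (k s : ℤ)) * x r / x s) p /
      (ellTheta (x r / x s) p * ellFac (x r * x s) q p (k r + k s))) _
      (fun s => (if s < i then q⁻¹ else 1) *
        (ellTheta (q * X i / X s) p / (ellTheta (X i / X s) p * ellTheta (X i * X s) p))) i]
  · have e : ∑ r : Fin n, (r : ℕ) * Function.update k i (k i + 1) r = ∑ r : Fin n, (r : ℕ) * k r + i := by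
      rw [← Finset.add_sum_erase _ _ (Finset.mem_univ i),
        ← Finset.add_sum_erase _ (fun r : Fin n => (r : ℕ) * k r) (Finset.mem_univ i),
        Function.update_self, Finset.sum_congr rfl fun r hr => by
          rw [Function.update_of_ne (Finset.ne_of_mem_erase hr)]]
      ring
    have e2 : ∏ s ∈ Finset.univ.erase i, (if s < i then q⁻¹ else 1) = q⁻¹ ^ (i : ℕ) := by
      rw [← Finset.prod_filter, Finset.prod_const]
      congr 1
      rw [← Fin.card_Iio i]
      congr 1
      ext s
      simp only [Finset.mem_Iio, Finset.mem_filter, Finset.mem_erase, Finset.mem_univ, and_true]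
      exact ⟨fun h => h.2, fun h => ⟨h.ne, h⟩⟩
    rw [e, Finset.prod_mul_distrib, e2, pow_add]
    have : q⁻¹ ^ (i : ℕ) * q ^ (i : ℕ) = 1 := by rw [← mul_pow, inv_mul_cancel₀ hq, one_pow]
    linear_combination ((∏ r, ∏ s ∈ Finset.Ioi r, ellTheta (q ^ ((k r : ℤ) - (k s : ℤ)) * x r / x s) p /
          (ellTheta (x r / x s) p * ellFac (x r * x s) q p (k r + k s))) *
        q ^ (∑ r : Fin n, (r : ℕ) * k r) *
        ∏ s ∈ Finset.univ.erase i,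
          ellTheta (q * X i / X s) p / (ellTheta (X i / X s) p * ellTheta (X i * X s) p)) * this
  · intro r s _ hr hs
    rw [Function.update_of_ne hr, Function.update_of_ne hs]
  · intro s hs
    have h1 := hXX i s hs.ne
    rw [Function.update_self, Function.update_of_ne hs.ne', add_right_comm, hfac, hdiv,
      if_neg hs.not_gt, one_mul]
    rw [show q ^ (((k i + 1 : ℕ) : ℤ) - (k s : ℤ)) * x i / x s = q * X i / X s by
      rw [mul_div_assoc q, ← hdiv i s, Nat.cast_add, Nat.cast_one, add_sub_right_comm, zpow_add_one₀ hq]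
      ring]
    field_simp
  · intro r hr
    have h1 := hXX r i hr.ne
    rw [Function.update_self, Function.update_of_ne hr.ne, ← add_assoc, hfac, hdiv, if_pos hr]
    rw [show q ^ ((k r : ℤ) - ((k i + 1 : ℕ) : ℤ)) * x r / x i = X r / (q * X i) by
      rw [mul_comm q, ← div_div, ← hdiv r i, Nat.cast_add, Nat.cast_one, ← sub_sub, zpow_sub_one₀ hq]
      field_simp]
    have h2 := hX0 r
    have h3 := hX0 i
    rw [ellTheta_div_comm hp (mul_ne_zero hq h3) h2, ellTheta_div_comm hp h2 h3 (y := X i),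
      mul_comm (X i) (X r)]
    field_simp

theorem dnFactor_update {y : Fin (n - 1) → ℂ} (hp : ‖p‖ < 1) (hq : q ≠ 0) (hx : ∀ r, x r ≠ 0)
    (hX : ∀ r, X r = x r * q ^ k r) (hXX : ∀ r s, r ≠ s → ellTheta (X r / X s) p ≠ 0) {G : ℂ}
    (hG : G = g * q ^ ∑ r, k r) (i : Fin n) :
    dnFactor q p g x y (Function.update k i (k i + 1)) = dnFactor q p g x y k *
      ((∏ s ∈ Finset.univ.erase i,
          ellTheta (q * X i / X s) p / (ellTheta (X i / X s) p * ellTheta (X i * X s) p)) *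
        (∏ s, ellTheta (X i * y s) p * ellTheta (X i / y s) p /
          (ellTheta (G * y s) p * ellTheta (G / y s) p)) *
        (ellTheta (G * x i) p / (ellTheta (g * X i) p * ∏ s, ellTheta (q * X i / x s) p) *
          ∏ s ∈ Finset.univ.erase i, ellTheta (G * x s) p * ellTheta (G / X s) p) *
        ellTheta (q ^ (∑ r, k r + 1)) p) := by
  have h1 := dnFactor_pairs_update hp hq hx hX hXX i
  have h2 : ∏ s, (∏ r, ellFacs [x r * y s, x r / y s] q p (Function.update k i (k i + 1) r)) /
        ellFacs [g * y s, g / y s] q p (∑ r, k r + 1) =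
      (∏ s, (∏ r, ellFacs [x r * y s, x r / y s] q p (k r)) /
        ellFacs [g * y s, g / y s] q p (∑ r, k r)) *
      ∏ s, ellTheta (X i * y s) p * ellTheta (X i / y s) p /
          (ellTheta (G * y s) p * ellTheta (G / y s) p) := by
    rw [← Finset.prod_mul_distrib]
    refine Finset.prod_congr rfl fun s _ => ?_
    rw [← Finset.mul_prod_erase _ _ (Finset.mem_univ i),
      ← Finset.mul_prod_erase _ (fun r => ellFacs [x r * y s, x r / y s] q p (k r))
        (Finset.mem_univ i), Function.update_self, Finset.prod_congr rfl fun r hr => by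
          rw [Function.update_of_ne (Finset.ne_of_mem_erase hr)]]
    simp only [ellFacs_cons, ellFacs_nil, ellFac_succ, hX i, hG]
    rw [mul_right_comm (x i) (y s), mul_right_comm g (y s), div_mul_eq_mul_div, div_mul_eq_mul_div]
    ring
  have h3 : ∏ r, ellFac (g * x r) q p (∑ r, k r + 1) *
        ellFac (g / x r) q p (∑ r, k r + 1 - Function.update k i (k i + 1) r) /
        (ellFac (g * x r) q p (Function.update k i (k i + 1) r) *
          ∏ s, ellFac (q * x r / x s) q p (Function.update k i (k i + 1) r)) =
      (∏ r, ellFac (g * x r) q p (∑ r, k r) * ellFac (g / x r) q p (∑ r, k r - k r) /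
        (ellFac (g * x r) q p (k r) * ∏ s, ellFac (q * x r / x s) q p (k r))) *
      (ellTheta (G * x i) p / (ellTheta (g * X i) p * ∏ s, ellTheta (q * X i / x s) p) *
          ∏ s ∈ Finset.univ.erase i, ellTheta (G * x s) p * ellTheta (G / X s) p) := by
    rw [← Finset.mul_prod_erase _ _ (Finset.mem_univ i),
      ← Finset.mul_prod_erase _ (fun r => ellFac (g * x r) q p (∑ r, k r) *
        ellFac (g / x r) q p (∑ r, k r - k r) /
        (ellFac (g * x r) q p (k r) * ∏ s, ellFac (q * x r / x s) q p (k r))) (Finset.mem_univ i),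
      mul_mul_mul_comm, ← Finset.prod_mul_distrib]
    congr 1
    · simp only [Function.update_self, ellFac_succ, Finset.prod_mul_distrib, hX i, hG]
      rw [Nat.add_sub_add_right, mul_right_comm g (x i), ← mul_assoc g (x i)]
      have : ∀ s, q * x i / x s * q ^ k i = q * (x i * q ^ k i) / x s := fun s => by ring
      simp only [this]
      ring
    · refine Finset.prod_congr rfl fun r hr => ?_
      have hkr : k r ≤ ∑ r, k r := Finset.single_le_sum (fun _ _ => Nat.zero_le _) (Finset.mem_univ r)
      rw [Function.update_of_ne (Finset.ne_of_mem_erase hr), ellFac_succ, Nat.sub_add_comm hkr,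
        ellFac_succ, mul_right_comm g (x r), ← hG]
      have : g / x r * q ^ (∑ r, k r - k r) = G / X r := by
        have := hx r
        rw [hX, hG, pow_sub₀ _ hq hkr]
        field_simp
      rw [this]
      ring
  unfold dnFactor
  rw [sum_update_succ, h2, h3, ellFac_succ, pow_succ']
  linear_combination ((∏ s, (∏ r, ellFacs [x r * y s, x r / y s] q p (k r)) /
        ellFacs [g * y s, g / y s] q p (∑ r, k r)) *
      (∏ s, ellTheta (X i * y s) p * ellTheta (X i / y s) p /
          (ellTheta (G * y s) p * ellTheta (G / y s) p)) *
      (∏ r, ellFac (g * x r) q p (∑ r, k r) * ellFac (g / x r) q p (∑ r, k r - k r) /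
        (ellFac (g * x r) q p (k r) * ∏ s, ellFac (q * x r / x s) q p (k r))) *
      (ellTheta (G * x i) p / (ellTheta (g * X i) p * ∏ s, ellTheta (q * X i / x s) p) *
          ∏ s ∈ Finset.univ.erase i, ellTheta (G * x s) p * ellTheta (G / X s) p) *
      ellFac q q p (∑ r, k r) * ellTheta (q * q ^ ∑ r, k r) p) * h1

end Step

/-! ### The type D weights of fixed total degree sum to one -/

section DnSum

variable {n N : ℕ} {q p g : ℂ} {x : Fin n → ℂ} {y : Fin (n - 1) → ℂ}

/-- Up to inversion the argument is `q ^ m * x r / x s` with `0 ≤ m ≤ N`. The case `m = 0` is `hxx`;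
for `m ≥ 1` it is the factor of index `m - 1` in `hqx`. -/
theorem ellTheta_shifted_div_ne_zero (hp : ‖p‖ < 1) (hq : q ≠ 0) (hx : ∀ r, x r ≠ 0)
    (hxx : ∀ r s, r < s → ellTheta (x r / x s) p ≠ 0)
    (hqx : ∀ r s, ellFac (q * x r / x s) q p N ≠ 0) (k : Fin n → ℕ) (hk : ∑ r, k r ≤ N)
    {r s : Fin n} (hrs : r ≠ s) : ellTheta (x r * q ^ k r / (x s * q ^ k s)) p ≠ 0 := by
  have hX0 : ∀ r, x r * q ^ k r ≠ 0 := fun r => mul_ne_zero (hx r) (pow_ne_zero _ hq)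
  wlog hle : k s ≤ k r generalizing r s
  · rw [ellTheta_div_comm hp (hX0 s) (hX0 r)]
    exact mul_ne_zero (neg_ne_zero.2 (div_ne_zero (hX0 r) (hX0 s))) (this hrs.symm (le_of_not_ge hle))
  obtain ⟨m, hm⟩ := Nat.exists_eq_add_of_le hle
  have h0 := hx s
  rcases m with _ | m
  · rw [hm, add_zero, mul_div_mul_right _ _ (pow_ne_zero _ hq)]
    rcases lt_or_gt_of_ne hrs with h | h
    · exact hxx r s h
    · rw [ellTheta_div_comm hp h0 (hx r)]
      exact mul_ne_zero (neg_ne_zero.2 (div_ne_zero (hx r) h0)) (hxx s r h)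
  · have := ellFac_ne_zero_iff.1 (hqx r s) m (by
      have : k r ≤ ∑ r, k r := Finset.single_le_sum (fun _ _ => Nat.zero_le _) (Finset.mem_univ r)
      omega)
    convert this using 2
    rw [hm]
    field_simp
    ring

/-- The weight that moves the mass at `k` to the index raised in coordinate `i`. -/
noncomputable def dnRaise (p G : ℂ) (X : Fin n → ℂ) (y : Fin (n - 1) → ℂ) (i : Fin n) : ℂ :=
  (∏ s, ellTheta (X i * y s) p * ellTheta (X i / y s) p /
      (ellTheta (G * y s) p * ellTheta (G / y s) p)) *
    ∏ s ∈ Finset.univ.erase i, ellTheta (G * X s) p * ellTheta (G / X s) p /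
      (ellTheta (X i * X s) p * ellTheta (X i / X s) p)

/-- The weight with which the mass at `k` is received from the index lowered in coordinate `i`. -/
noncomputable def dnLower (q p G : ℂ) (x X : Fin n → ℂ) (K : ℕ) (i : Fin n) : ℂ :=
  ellTheta (G * (X i / q ^ K)) p * (∏ s, ellTheta (X i / x s) p) *
      (∏ s ∈ Finset.univ.erase i, ellTheta (G * X s) p / ellTheta (X i / X s) p) /
    (ellTheta (q ^ K) p * ∏ s, ellTheta (G * x s) p)

/-- A detailed balance relation: the mass sent from `k` to `k + e_i` equals the mass that `k + e_i`
receives along direction `i`. -/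
theorem dnFactor_mul_dnRaise (hp : ‖p‖ < 1) (hq : q ≠ 0) (hx : ∀ r, x r ≠ 0)
    (hxx : ∀ r s, r < s → ellTheta (x r / x s) p ≠ 0 ∧ ellFac (x r * x s) q p N ≠ 0)
    (hgx : ∀ r, ellFac (g * x r) q p N ≠ 0) (hqx : ∀ r s, ellFac (q * x r / x s) q p N ≠ 0)
    (k : Fin n → ℕ) (hk : ∑ r, k r < N) (i : Fin n) :
    dnFactor q p g x y k * dnRaise p (g * q ^ ∑ r, k r) (fun r => x r * q ^ k r) y i =
      dnFactor q p g x y (Function.update k i (k i + 1)) *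
        dnLower q p (g * q ^ ∑ r, k r) x (fun r => x r * q ^ Function.update k i (k i + 1) r)
          (∑ r, k r + 1) i := by
  set X : Fin n → ℂ := fun r => x r * q ^ k r with hX
  set G := g * q ^ ∑ r, k r with hG
  have hki : k i ≤ ∑ r, k r := Finset.single_le_sum (fun _ _ => Nat.zero_le _) (Finset.mem_univ i)
  have hXX : ∀ r s, r ≠ s → ellTheta (X r / X s) p ≠ 0 := fun r s hrs =>
    ellTheta_shifted_div_ne_zero hp hq hx (fun r s h => (hxx r s h).1) hqx k hk.le hrs
  have hqXX : ∀ s, s ≠ i → ellTheta (q * X i / X s) p ≠ 0 := fun s hs => by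
    have := ellTheta_shifted_div_ne_zero hp hq hx (fun r s h => (hxx r s h).1) hqx
      (Function.update k i (k i + 1)) (by rw [sum_update_succ]; omega) hs.symm
    rw [Function.update_self, Function.update_of_ne hs] at this
    convert this using 2
    rw [hX, pow_succ]
    ring
  have hgX : ellTheta (g * X i) p ≠ 0 := by
    have := ellFac_ne_zero_iff.1 (hgx i) (k i) (by omega)
    rwa [mul_assoc] at this
  have hGx : ∏ s, ellTheta (G * x s) p ≠ 0 := Finset.prod_ne_zero_iff.2 fun s _ => by
    have := ellFac_ne_zero_iff.1 (hgx s) (∑ r, k r) hk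
    rwa [mul_right_comm] at this
  have hqXx : ∏ s, ellTheta (q * X i / x s) p ≠ 0 := Finset.prod_ne_zero_iff.2 fun s _ => by
    have := ellFac_ne_zero_iff.1 (hqx i s) (k i) (by omega)
    convert this using 2
    rw [hX]
    ring
  have hqK : ellTheta (q ^ (∑ r, k r + 1)) p ≠ 0 := by
    have := ellFac_ne_zero_iff.1 (hqx i i) (∑ r, k r) hk
    rwa [mul_div_assoc, div_self (hx i), mul_one, ← pow_succ'] at this
  rw [dnFactor_update (X := X) hp hq hx (fun _ => rfl) hXX hG i, mul_assoc]
  congr 1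
  have e1 : x i * q ^ Function.update k i (k i + 1) i = q * X i := by
    rw [Function.update_self, hX, pow_succ]
    ring
  have e2 : G * (q * X i / q ^ (∑ r, k r + 1)) = g * X i := by
    rw [hG]
    field_simp
    ring
  have e3 : ∏ s ∈ Finset.univ.erase i, ellTheta (G * (x s * q ^ Function.update k i (k i + 1) s)) p /
      ellTheta (q * X i / (x s * q ^ Function.update k i (k i + 1) s)) p =
      ∏ s ∈ Finset.univ.erase i, ellTheta (G * X s) p / ellTheta (q * X i / X s) p :=
    Finset.prod_congr rfl fun s hs => by rw [Function.update_of_ne (Finset.ne_of_mem_erase hs)]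
  rw [dnRaise, dnLower, e1, e2, e3, ← Finset.mul_prod_erase _ (fun s => ellTheta (G * x s) p)
    (Finset.mem_univ i)]
  rw [← Finset.mul_prod_erase _ (fun s => ellTheta (G * x s) p) (Finset.mem_univ i)] at hGx
  have h4 : ∏ s ∈ Finset.univ.erase i, ellTheta (G * X s) p * ellTheta (G / X s) p /
      (ellTheta (X i * X s) p * ellTheta (X i / X s) p) =
      (∏ s ∈ Finset.univ.erase i,
          ellTheta (q * X i / X s) p / (ellTheta (X i / X s) p * ellTheta (X i * X s) p)) *
        (∏ s ∈ Finset.univ.erase i, ellTheta (G * x s) p * ellTheta (G / X s) p) *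
        (∏ s ∈ Finset.univ.erase i, ellTheta (G * X s) p / ellTheta (q * X i / X s) p) /
        ∏ s ∈ Finset.univ.erase i, ellTheta (G * x s) p := by
    rw [← Finset.prod_mul_distrib, ← Finset.prod_mul_distrib, ← Finset.prod_div_distrib]
    refine Finset.prod_congr rfl fun s hs => ?_
    have h5 := hqXX s (Finset.ne_of_mem_erase hs)
    have h6 := Finset.prod_ne_zero_iff.1 (mul_ne_zero_iff.1 hGx).2 s hs
    rw [mul_comm (ellTheta (X i * X s) p)]
    generalize ellTheta (q * X i / X s) p = c1 at *
    field_simp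
  rw [h4]
  have h7 := (mul_ne_zero_iff.1 hGx).1
  have h8 := (mul_ne_zero_iff.1 hGx).2
  generalize ∏ s ∈ Finset.univ.erase i, ellTheta (G * x s) p = c1 at *
  generalize ∏ s, ellTheta (q * X i / x s) p = c2 at *
  generalize ellTheta (g * X i) p = c3 at *
  generalize ellTheta (G * x i) p = c4 at *
  generalize ellTheta (q ^ (∑ r, k r + 1)) p = c5 at *
  generalize ∏ s ∈ Finset.univ.erase i, ellTheta (G * X s) p / ellTheta (q * X i / X s) p = c6
  generalize ∏ s ∈ Finset.univ.erase i, ellTheta (G * x s) p * ellTheta (G / X s) p = c7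
  generalize ∏ s ∈ Finset.univ.erase i,
    ellTheta (q * X i / X s) p / (ellTheta (X i / X s) p * ellTheta (X i * X s) p) = c8
  generalize ∏ s, ellTheta (X i * y s) p * ellTheta (X i / y s) p /
          (ellTheta (G * y s) p * ellTheta (G / y s) p) = c9
  field_simp

theorem sum_dnRaise (hn : 1 ≤ n) (hp : ‖p‖ < 1) (hq : q ≠ 0) (hx : ∀ r, x r ≠ 0) (hy : ∀ s, y s ≠ 0)
    (hg : g ≠ 0) (hxx : ∀ r s, r < s → ellTheta (x r / x s) p ≠ 0 ∧ ellFac (x r * x s) q p N ≠ 0)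
    (hgy : ∀ s, ellFacs [g * y s, g / y s] q p N ≠ 0)
    (hqx : ∀ r s, ellFac (q * x r / x s) q p N ≠ 0) (k : Fin n → ℕ) (hk : ∑ r, k r < N) :
    ∑ i, dnRaise p (g * q ^ ∑ r, k r) (fun r => x r * q ^ k r) y i = 1 := by
  refine sum_partial_fraction_D hn hp (mul_ne_zero hg (pow_ne_zero _ hq)) _ y
    (fun r => mul_ne_zero (hx r) (pow_ne_zero _ hq)) hy (fun r s hrs => ⟨?_, ?_⟩) fun s => ?_
  · have hle : k r + k s ≤ ∑ r, k r := by
      rw [← Finset.add_sum_erase _ _ (Finset.mem_univ r)]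
      exact Nat.add_le_add_left (Finset.single_le_sum (f := k) (fun _ _ => Nat.zero_le _)
        (Finset.mem_erase.2 ⟨hrs.symm, Finset.mem_univ s⟩)) _
    have h : ellFac (x r * x s) q p N ≠ 0 := by
      rcases lt_or_gt_of_ne hrs with h | h
      · exact (hxx r s h).2
      · rw [mul_comm]
        exact (hxx s r h).2
    have := ellFac_ne_zero_iff.1 h (k r + k s) (by omega)
    convert this using 2
    ring
  · exact ellTheta_shifted_div_ne_zero hp hq hx (fun r s h => (hxx r s h).1) hqx k hk.le hrs
  · have h := hgy s
    simp only [ellFacs_cons, ellFacs_nil, mul_one] at h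
    have h1 := ellFac_ne_zero_iff.1 (mul_ne_zero_iff.1 h).1 _ hk
    have h2 := ellFac_ne_zero_iff.1 (mul_ne_zero_iff.1 h).2 _ hk
    rw [mul_right_comm] at h1
    rw [div_mul_eq_mul_div] at h2
    exact ⟨h1, h2⟩

theorem sum_dnLower (hn : 1 ≤ n) (hp : ‖p‖ < 1) (hq : q ≠ 0) (hx : ∀ r, x r ≠ 0)
    (hg : g ≠ 0) (hxx : ∀ r s, r < s → ellTheta (x r / x s) p ≠ 0)
    (hgx : ∀ r, ellFac (g * x r) q p N ≠ 0) (hqx : ∀ r s, ellFac (q * x r / x s) q p N ≠ 0)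
    {K : ℕ} (hK : K < N) (k : Fin n → ℕ) (hk : ∑ r, k r = K + 1) :
    ∑ i, dnLower q p (g * q ^ K) x (fun r => x r * q ^ k r) (K + 1) i = 1 := by
  -- The diagonal case `r = s` of `hqx` says that `(q; q, p)_N ≠ 0`.
  have hqj : ∀ j, 1 ≤ j → j ≤ N → ellTheta (q ^ j) p ≠ 0 := fun j h1 h2 => by
    have := ellFac_ne_zero_iff.1 (hqx ⟨0, hn⟩ ⟨0, hn⟩) (j - 1) (by omega)
    rwa [mul_div_assoc, div_self (hx _), mul_one, ← pow_succ', Nat.sub_add_cancel h1] at this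
  have h := sum_partial_fraction_A hp hq Finset.univ x (fun r => x r * q ^ k r) k hx (fun _ => rfl)
    (fun r _ s _ hrs => ellTheta_shifted_div_ne_zero hp hq hx hxx hqx k (by omega) hrs)
    (fun j h1 h2 => hqj j h1 (by omega)) (t := g * q ^ K) (mul_ne_zero hg (pow_ne_zero _ hq))
  rw [hk] at h
  simp only [dnLower]
  rw [← Finset.sum_div, h, div_self]
  refine mul_ne_zero (hqj _ (by omega) (by omega)) (Finset.prod_ne_zero_iff.2 fun s _ => ?_)
  have := ellFac_ne_zero_iff.1 (hgx s) K hK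
  rwa [mul_right_comm] at this

/-- Induction on `K`: the mass leaving level `K` is all of it, by `sum_dnRaise`, and fills level `K
+ 1` exactly, by `sum_dnLower`. -/
theorem sum_dnFactor_eq_one (hn : 1 ≤ n) (hp : ‖p‖ < 1) (hq : q ≠ 0) (hx : ∀ r, x r ≠ 0)
    (hy : ∀ s, y s ≠ 0) (hg : g ≠ 0)
    (hxx : ∀ r s, r < s → ellTheta (x r / x s) p ≠ 0 ∧ ellFac (x r * x s) q p N ≠ 0)
    (hgy : ∀ s, ellFacs [g * y s, g / y s] q p N ≠ 0) (hgx : ∀ r, ellFac (g * x r) q p N ≠ 0)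
    (hqx : ∀ r s, ellFac (q * x r / x s) q p N ≠ 0) {K : ℕ} (hK : K ≤ N) :
    ∑ k ∈ Finset.Nat.antidiagonalTuple n K, dnFactor q p g x y k = 1 := by
  induction K with
  | zero =>
    rw [Finset.Nat.antidiagonalTuple_zero_right, Finset.sum_singleton]
    have : ∀ r s : Fin n, r < s → ellTheta (x r / x s) p ≠ 0 := fun r s h => (hxx r s h).1
    have e : ∏ r, ∏ s ∈ Finset.Ioi r, ellTheta (x r / x s) p ≠ 0 := Finset.prod_ne_zero_iff.2
      fun r _ => Finset.prod_ne_zero_iff.2 fun s hs => this r s (Finset.mem_Ioi.1 hs)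
    simpa [dnFactor, ellFac_zero, ellFacs_cons, ellFacs_nil] using e
  | succ K ih =>
    rw [← ih (by omega)]
    symm
    calc ∑ k ∈ Finset.Nat.antidiagonalTuple n K, dnFactor q p g x y k
        = ∑ k ∈ Finset.Nat.antidiagonalTuple n K, ∑ i, dnFactor q p g x y (Function.update k i (k i + 1)) *
            dnLower q p (g * q ^ K) x (fun r => x r * q ^ Function.update k i (k i + 1) r) (K + 1) i := by
          refine Finset.sum_congr rfl fun k hk => ?_
          rw [Finset.Nat.mem_antidiagonalTuple] at hk
          rw [← mul_one (dnFactor q p g x y k), ← sum_dnRaise hn hp hq hx hy hg hxx hgy hqx k (by omega),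
            Finset.mul_sum]
          refine Finset.sum_congr rfl fun i _ => ?_
          rw [dnFactor_mul_dnRaise hp hq hx hxx hgx hqx k (by omega), hk]
      _ = ∑ i, ∑ k ∈ Finset.Nat.antidiagonalTuple n (K + 1), dnFactor q p g x y k *
            dnLower q p (g * q ^ K) x (fun r => x r * q ^ k r) (K + 1) i := by
          rw [Finset.sum_comm]
          refine Finset.sum_congr rfl fun i _ => ?_
          refine Finset.sum_of_injOn (fun k => Function.update k i (k i + 1)) ?_ ?_ ?_ fun _ _ => rfl
          · intro k _ l _ hkl
            have h : ∀ r, Function.update k i (k i + 1) r = Function.update l i (l i + 1) r := congrFun hkl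
            funext r
            by_cases hr : r = i
            · subst hr
              simpa using h r
            · simpa [hr] using h r
          · intro k hk
            simp only [Finset.mem_coe, Finset.Nat.mem_antidiagonalTuple] at hk ⊢
            rw [sum_update_succ, hk]
          · intro k hk hk'
            rw [Finset.Nat.mem_antidiagonalTuple] at hk
            have hki : k i = 0 := by
              by_contra h0
              refine hk' ⟨Function.update k i (k i - 1), ?_, ?_⟩
              · have := sum_update_succ (Function.update k i (k i - 1)) i
                rw [Function.update_self, Function.update_idem, Nat.sub_add_cancel (by omega),
                  Function.update_eq_self, hk] at this
                simp only [Finset.mem_coe, Finset.Nat.mem_antidiagonalTuple]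
                omega
              · simp [Nat.sub_add_cancel (Nat.one_le_iff_ne_zero.2 h0)]
            -- An index with `k i = 0` is not reached in direction `i`; its share vanishes through
            -- the factor `s = i`, which is `θ(1)`.
            have : ∏ s, ellTheta (x i * q ^ k i / x s) p = 0 :=
              Finset.prod_eq_zero (Finset.mem_univ i) (by
                rw [hki, pow_zero, mul_one, div_self (hx i), ellTheta_one hp])
            simp [dnLower, this]
      _ = _ := by
          rw [Finset.sum_comm]
          refine Finset.sum_congr rfl fun k hk => ?_
          rw [Finset.Nat.mem_antidiagonalTuple] at hk
          rw [← Finset.mul_sum, sum_dnLower hn hp hq hx hg (fun r s h => (hxx r s h).1) hgx hqx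
            (by omega) k hk, mul_one]

end DnSum

/-! ### The Frenkel–Turaev sum from the case `n = 2` -/

/-- The condition on `w` means `z q^(N-1-i) = (w q^i)⁻¹`, so inversion of theta turns the last `k`
factors of `(z)_N` into the first `k` factors of `(w)_k`. -/
theorem ellFac_reverse {q p z w : ℂ} {N k : ℕ} (hp : ‖p‖ < 1) (hq : q ≠ 0)
    (hw : w * z * q ^ N = q) (hk : k ≤ N) :
    ellFac z q p N = ellFac z q p (N - k) *
      (ellFac w q p k * (z ^ k * ∏ i ∈ Finset.range k, -q ^ (N - 1 - i))) := by
  have hw0 : w ≠ 0 := by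
    rintro rfl
    exact hq (by simpa using hw.symm)
  induction k with
  | zero => simp [ellFac_zero]
  | succ k ih =>
    obtain ⟨m, rfl⟩ : ∃ m, N = m + k + 1 := ⟨N - (k + 1), by omega⟩
    have e1 : m + k + 1 - k = m + 1 := by omega
    have e2 : m + k + 1 - (k + 1) = m := by omega
    have e3 : m + k + 1 - 1 - k = m := by omega
    have e4 : z * q ^ m = (w * q ^ k)⁻¹ := by
      field_simp
      rw [pow_add, pow_add, pow_one] at hw
      have : w * z * q ^ m * q ^ k = 1 := mul_right_cancel₀ hq (by linear_combination hw)
      linear_combination this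
    have h5 := ellTheta_inv hp (mul_ne_zero hw0 (pow_ne_zero k hq))
    rw [div_eq_mul_inv, ← e4] at h5
    rw [ih (by omega), Finset.prod_range_succ, e1, e2, e3, ellFac_succ, ellFac_succ, h5]
    ring

theorem ellFac_sub_eq {q p z w : ℂ} {N k : ℕ} (hp : ‖p‖ < 1) (hq : q ≠ 0) (hz : z ≠ 0)
    (hw : w * z * q ^ N = q) (hk : k ≤ N) (hwk : ellFac w q p k ≠ 0) :
    ellFac z q p (N - k) = ellFac w q p N * (z ^ N * ∏ i ∈ Finset.range N, -q ^ (N - 1 - i)) /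
      (ellFac w q p k * (z ^ k * ∏ i ∈ Finset.range k, -q ^ (N - 1 - i))) := by
  have h0 : ∏ i ∈ Finset.range k, -q ^ (N - 1 - i) ≠ 0 :=
    Finset.prod_ne_zero_iff.2 fun i _ => neg_ne_zero.2 (pow_ne_zero _ hq)
  have hzk := pow_ne_zero k hz
  have h := ellFac_reverse hp hq hw le_rfl
  rw [Nat.sub_self, ellFac_zero, one_mul] at h
  rw [eq_div_iff (mul_ne_zero hwk (mul_ne_zero hzk h0)), ← ellFac_reverse hp hq hw hk, h]

theorem ellFac_succ' (a q p : ℂ) (k : ℕ) :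
    ellFac a q p (k + 1) = ellTheta a p * ellFac (a * q) q p k := by
  rw [ellFac, Finset.prod_range_succ', ellFac, mul_comm, pow_zero, mul_one]
  congr 1
  exact Finset.prod_congr rfl fun j _ => by rw [mul_assoc, pow_succ']

theorem ellFac_ne_zero_of_reverse {q p z w : ℂ} {N : ℕ} (hp : ‖p‖ < 1) (hq : q ≠ 0)
    (hw : w * z * q ^ N = q) (h : ellFac z q p N ≠ 0) : ellFac w q p N ≠ 0 := by
  rw [ellFac_reverse hp hq hw le_rfl] at h
  exact (mul_ne_zero_iff.1 (mul_ne_zero_iff.1 h).2).1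

theorem dnFactor_two (q p g x₁ x₂ y : ℂ) (hx₁ : x₁ ≠ 0) (hx₂ : x₂ ≠ 0) {N k : ℕ} (hk : k ≤ N) :
    dnFactor (n := 2) q p g ![x₁, x₂] (fun _ => y) ![k, N - k] =
      ellTheta (q ^ ((k : ℤ) - ((N - k : ℕ) : ℤ)) * x₁ / x₂) p /
          (ellTheta (x₁ / x₂) p * ellFac (x₁ * x₂) q p N) *
        (ellFac (x₁ * y) q p k * ellFac (x₁ / y) q p k *
          (ellFac (x₂ * y) q p (N - k) * ellFac (x₂ / y) q p (N - k)) /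
          (ellFac (g * y) q p N * ellFac (g / y) q p N)) *
        (ellFac (g * x₁) q p N * ellFac (g / x₁) q p (N - k) /
          (ellFac (g * x₁) q p k * (ellFac q q p k * ellFac (q * x₁ / x₂) q p k)) *
        (ellFac (g * x₂) q p N * ellFac (g / x₂) q p k /
          (ellFac (g * x₂) q p (N - k) *
            (ellFac (q * x₂ / x₁) q p (N - k) * ellFac q q p (N - k))))) *
        q ^ (N - k) * ellFac q q p N := by
  have h1 : k + (N - k) = N := by omega
  have h2 : N - (N - k) = k := by omega
  have h0 : Finset.Ioi (0 : Fin 2) = {1} := by decide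
  have h0' : Finset.Ioi (1 : Fin 2) = ∅ := by decide
  simp [dnFactor, Fin.sum_univ_two, Fin.prod_univ_two, h1, h2, h0, h0', ellFacs_cons, ellFacs_nil,
    mul_div_cancel_right₀ q hx₁, mul_div_cancel_right₀ q hx₂]
  left; left; left
  ring

/-- The Frenkel–Turaev summation, for parameters in general position. -/
theorem sum_tenVNineTerm_of_generic {a b c d q p : ℂ} {N : ℕ} (hp : ‖p‖ < 1) (hq : q ≠ 0)
    (ha : a ≠ 0) (hb : b ≠ 0) (hc : c ≠ 0) (hd : d ≠ 0) (haj : ∀ j, ellTheta (a * q ^ j) p ≠ 0)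
    (hqN : ellFac q q p N ≠ 0) (h1 : ellFac (a * q / b) q p N ≠ 0)
    (h2 : ellFac (a * q / c) q p N ≠ 0) (h3 : ellFac (a * q / d) q p N ≠ 0)
    (h4 : ellFac (a * q / (b * c)) q p N ≠ 0) (h5 : ellFac (a * q / (b * d)) q p N ≠ 0)
    (h6 : ellFac (a * q / (c * d)) q p N ≠ 0) (h7 : ellFac (a * q / (b * c * d)) q p N ≠ 0)
    (h8 : ellFac (a ^ 2 * q ^ (1 + N) / (b * c * d)) q p N ≠ 0) :
    ∑ k ∈ Finset.range (N + 1), tenVNineTerm a b c d q p N k =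
      ellFacs [a * q, a * q / (b * c), a * q / (b * d), a * q / (c * d)] q p N /
        ellFacs [a * q / b, a * q / c, a * q / d, a * q / (b * c * d)] q p N := by
  -- The parameters of the `n = 2` sum are forced by `x₁ y = b`, `x₁ / y = c`, `x₁ / x₂ = a q^N` and
  -- `g / x₂ = d`.
  obtain ⟨x₁, hx₁⟩ := IsAlgClosed.exists_pow_nat_eq (b * c) two_pos
  have hx₁0 : x₁ ≠ 0 := by
    rintro rfl
    exact mul_ne_zero hb hc (by simpa using hx₁.symm)
  have hQ : q ^ N ≠ 0 := pow_ne_zero _ hq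
  have hcx : c = x₁ ^ 2 / b := by rw [hx₁]; field_simp
  obtain ⟨x₂, hx₂⟩ : ∃ x₂, x₂ = x₁ / (a * q ^ N) := ⟨_, rfl⟩
  obtain ⟨y, hy⟩ : ∃ y, y = b / x₁ := ⟨_, rfl⟩
  obtain ⟨g, hg⟩ : ∃ g, g = d * x₂ := ⟨_, rfl⟩
  have hx₂0 : x₂ ≠ 0 := by rw [hx₂]; positivity
  have hy0 : y ≠ 0 := by rw [hy]; positivity
  have hg0 : g ≠ 0 := by rw [hg]; positivity
  have e1 : x₁ * y = b := by rw [hy]; field_simp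
  have e2 : x₁ / y = c := by rw [hy, hcx]; field_simp
  have e3 : x₂ * y = b / (a * q ^ N) := by rw [hy, hx₂]; field_simp
  have e4 : x₂ / y = c / (a * q ^ N) := by rw [hy, hx₂, hcx]; field_simp
  have e5 : g * y = b * d / (a * q ^ N) := by rw [hg, mul_assoc, e3]; ring
  have e6 : g / y = c * d / (a * q ^ N) := by rw [hg, mul_div_assoc, e4]; ring
  have e7 : g * x₁ = b * c * d / (a * q ^ N) := by rw [hg, hx₂, ← hx₁]; ring
  have e8 : g / x₁ = d / (a * q ^ N) := by rw [hg, hx₂]; field_simp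
  have e9 : g * x₂ = b * c * d / (a ^ 2 * q ^ N * q ^ N) := by
    rw [hg, hx₂, ← hx₁]; field_simp
  have e10 : g / x₂ = d := by rw [hg]; field_simp
  have e11 : q * x₁ / x₂ = a * q ^ (N + 1) := by rw [hx₂, pow_succ]; field_simp
  have e12 : q * x₂ / x₁ = q / (a * q ^ N) := by rw [hx₂]; field_simp
  have e13 : x₁ * x₂ = b * c / (a * q ^ N) := by rw [hx₂, ← hx₁]; ring
  have e14 : x₁ / x₂ = a * q ^ N := by rw [hx₂]; field_simp
  have h9 : ellFac a q p N ≠ 0 := ellFac_ne_zero_iff.2 fun j _ => haj j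
  have h11 : ellFac (a * q ^ (N + 1)) q p N ≠ 0 := ellFac_ne_zero_iff.2 fun j _ => by
    rw [mul_assoc, ← pow_add]; exact haj _
  have r4 : ellFac (b * c / (a * q ^ N)) q p N ≠ 0 :=
    ellFac_ne_zero_of_reverse hp hq (by field_simp) h4
  have r5 : ellFac (b * d / (a * q ^ N)) q p N ≠ 0 :=
    ellFac_ne_zero_of_reverse hp hq (by field_simp) h5
  have r6 : ellFac (c * d / (a * q ^ N)) q p N ≠ 0 :=
    ellFac_ne_zero_of_reverse hp hq (by field_simp) h6
  have r7 : ellFac (b * c * d / (a * q ^ N)) q p N ≠ 0 :=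
    ellFac_ne_zero_of_reverse hp hq (by field_simp) h7
  have r8 : ellFac (b * c * d / (a ^ 2 * q ^ N * q ^ N)) q p N ≠ 0 :=
    ellFac_ne_zero_of_reverse hp hq (by rw [pow_add]; field_simp) h8
  have r9 : ellFac (q / (a * q ^ N)) q p N ≠ 0 :=
    ellFac_ne_zero_of_reverse hp hq (by field_simp) h9
  have hsum := sum_dnFactor_eq_one (n := 2) (N := N) (x := ![x₁, x₂]) (y := fun _ => y) (g := g)
    (K := N) one_le_two hp hq (by simp [Fin.forall_fin_two, hx₁0, hx₂0]) (fun _ => hy0) hg0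
    (by
      have := haj N
      simp [Fin.forall_fin_two, e13, e14, r4, this])
    (fun _ => by
      rw [ellFacs_cons, ellFacs_cons, ellFacs_nil, mul_one, e5, e6]
      exact mul_ne_zero r5 r6)
    (by simp [Fin.forall_fin_two, e7, e9, r7, r8])
    (by simp [Fin.forall_fin_two, hx₁0, hx₂0, e11, e12, h11, r9, hqN]) le_rfl
  rw [Finset.Nat.antidiagonalTuple_two, Finset.sum_map, Finset.Nat.sum_antidiagonal_eq_sum_range_succ_mk]
    at hsum
  -- Each `n = 2` weight is a term of the series times the reciprocal of the claimed value, so the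
  -- weights summing to `1` is the assertion.
  have hC : ∀ k ∈ Finset.range (N + 1), dnFactor (n := 2) q p g ![x₁, x₂] (fun _ => y) ![k, N - k] =
      ellFacs [a * q / b, a * q / c, a * q / d, a * q / (b * c * d)] q p N /
        ellFacs [a * q, a * q / (b * c), a * q / (b * d), a * q / (c * d)] q p N *
          tenVNineTerm a b c d q p N k := by
    intro k hk
    have hk : k ≤ N := Nat.lt_succ_iff.1 (Finset.mem_range.1 hk)
    have w1 : a * q / b * (b / (a * q ^ N)) * q ^ N = q := by field_simp
    have w2 : a * q / c * (c / (a * q ^ N)) * q ^ N = q := by field_simp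
    have w3 : a * q / d * (d / (a * q ^ N)) * q ^ N = q := by field_simp
    have w4 : a ^ 2 * q ^ (1 + N) / (b * c * d) * (b * c * d / (a ^ 2 * q ^ N * q ^ N)) * q ^ N = q := by
      rw [pow_add]; field_simp
    have w5 : a * (q / (a * q ^ N)) * q ^ N = q := by field_simp
    have w6 : (q ^ N)⁻¹ * q * q ^ N = q := by field_simp
    have n6 : ellFac (q ^ N)⁻¹ q p N ≠ 0 := ellFac_ne_zero_of_reverse hp hq w6 hqN
    have full : ∀ {z w : ℂ}, w * z * q ^ N = q →
        ellFac z q p N = ellFac w q p N * (z ^ N * ∏ i ∈ Finset.range N, -q ^ (N - 1 - i)) := by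
      intro z w hw
      have h := ellFac_reverse (p := p) hp hq hw le_rfl
      rwa [Nat.sub_self, ellFac_zero, one_mul] at h
    have hθ : q ^ ((k : ℤ) - ((N - k : ℕ) : ℤ)) * x₁ / x₂ = a * q ^ (2 * k) := by
      rw [mul_div_assoc, e14, Nat.cast_sub hk, zpow_sub₀ hq, zpow_sub₀ hq, zpow_natCast, zpow_natCast]
      field_simp
      ring
    have hqk : q ^ (N - k) = q ^ N / q ^ k := by
      rw [pow_sub₀ _ hq hk, div_eq_mul_inv]
    have haq : ellFac (a * q) q p N = ellFac a q p N * ellTheta (a * q ^ N) p / ellTheta a p := by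
      have := haj 0
      rw [pow_zero, mul_one] at this
      rw [eq_div_iff this, ← ellFac_succ, ellFac_succ', mul_comm]
    have t1 : b * c * d * (q ^ N)⁻¹ / a = b * c * d / (a * q ^ N) := by field_simp
    -- The monomials left by the reversals, of exponents `k` and `N`, balance.
    have pk : (b * c * d / (a ^ 2 * q ^ N * q ^ N)) ^ k * (q / (a * q ^ N)) ^ k * q ^ k =
        q ^ k * q ^ k * ((b / (a * q ^ N)) ^ k * (c / (a * q ^ N)) ^ k * (d / (a * q ^ N)) ^ k) := by
      simp only [← mul_pow]
      congr 1
      field_simp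
    have pN : (q / (a * q ^ N)) ^ N * (b * c / (a * q ^ N)) ^ N * (b * d / (a * q ^ N)) ^ N *
          (c * d / (a * q ^ N)) ^ N = q ^ N * ((b * c * d / (a * q ^ N)) ^ N *
          (b / (a * q ^ N)) ^ N * (c / (a * q ^ N)) ^ N * (d / (a * q ^ N)) ^ N) := by
      simp only [← mul_pow]
      congr 1
      field_simp
    have g1 := ellFac_ne_zero_of_le h1 hk
    have g2 := ellFac_ne_zero_of_le h2 hk
    have g3 := ellFac_ne_zero_of_le h3 hk
    have g8 := ellFac_ne_zero_of_le h8 hk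
    have g9 := ellFac_ne_zero_of_le h9 hk
    have g6 := ellFac_ne_zero_of_le n6 hk
    rw [dnFactor_two _ _ _ _ _ _ hx₁0 hx₂0 hk, hθ, e1, e2, e3, e4, e5, e6, e7, e8, e9, e10, e11, e12,
      e13, e14, hqk]
    rw [ellFac_sub_eq hp hq (by positivity) w1 hk g1, ellFac_sub_eq hp hq (by positivity) w2 hk g2,
      ellFac_sub_eq hp hq (by positivity) w3 hk g3, ellFac_sub_eq hp hq (by positivity) w4 hk g8,
      ellFac_sub_eq hp hq (by positivity) w5 hk g9, ellFac_sub_eq hp hq hq w6 hk g6,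
      full w4, full w6, full (z := b * c / (a * q ^ N)) (w := a * q / (b * c)) (by field_simp),
      full (z := b * d / (a * q ^ N)) (w := a * q / (b * d)) (by field_simp),
      full (z := c * d / (a * q ^ N)) (w := a * q / (c * d)) (by field_simp),
      full (z := b * c * d / (a * q ^ N)) (w := a * q / (b * c * d)) (by field_simp)]
    simp only [tenVNineTerm, ellFacs_cons, ellFacs_nil, mul_one, t1, haq, zpow_neg, zpow_natCast]
    have m1 : ∏ i ∈ Finset.range k, -q ^ (N - 1 - i) ≠ 0 :=
      Finset.prod_ne_zero_iff.2 fun i _ => neg_ne_zero.2 (pow_ne_zero _ hq)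
    have m2 : ∏ i ∈ Finset.range N, -q ^ (N - 1 - i) ≠ 0 :=
      Finset.prod_ne_zero_iff.2 fun i _ => neg_ne_zero.2 (pow_ne_zero _ hq)
    have m3 := haj 0
    rw [pow_zero, mul_one] at m3
    have m4 := haj N
    have qk := pow_ne_zero k hq
    have z1 : b / (a * q ^ N) ≠ 0 := by positivity
    have z2 : c / (a * q ^ N) ≠ 0 := by positivity
    have z3 : d / (a * q ^ N) ≠ 0 := by positivity
    have z4 : b * c * d / (a ^ 2 * q ^ N * q ^ N) ≠ 0 := by positivity
    have z5 : q / (a * q ^ N) ≠ 0 := by positivity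
    have z6 : b * c / (a * q ^ N) ≠ 0 := by positivity
    have z7 : b * d / (a * q ^ N) ≠ 0 := by positivity
    have z8 : c * d / (a * q ^ N) ≠ 0 := by positivity
    have y1k := pow_ne_zero k z1
    have y2k := pow_ne_zero k z2
    have y3k := pow_ne_zero k z3
    have y4k := pow_ne_zero k z4
    have y5k := pow_ne_zero k z5
    have y4N := pow_ne_zero N z4
    have y5N := pow_ne_zero N z5
    have y6N := pow_ne_zero N z6
    have y7N := pow_ne_zero N z7
    have y8N := pow_ne_zero N z8
    have y1N := pow_ne_zero N z1
    have y2N := pow_ne_zero N z2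
    have y3N := pow_ne_zero N z3
    generalize (b / (a * q ^ N)) ^ k = u1 at *
    generalize (c / (a * q ^ N)) ^ k = u2 at *
    generalize (d / (a * q ^ N)) ^ k = u3 at *
    generalize (b * c * d / (a ^ 2 * q ^ N * q ^ N)) ^ k = u4 at *
    generalize (q / (a * q ^ N)) ^ k = u5 at *
    generalize (b / (a * q ^ N)) ^ N = v1 at *
    generalize (c / (a * q ^ N)) ^ N = v2 at *
    generalize (d / (a * q ^ N)) ^ N = v3 at *
    generalize (b * c * d / (a ^ 2 * q ^ N * q ^ N)) ^ N = v4 at *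
    generalize (q / (a * q ^ N)) ^ N = v5 at *
    generalize (b * c / (a * q ^ N)) ^ N = v6 at *
    generalize (b * d / (a * q ^ N)) ^ N = v7 at *
    generalize (c * d / (a * q ^ N)) ^ N = v8 at *
    generalize (b * c * d / (a * q ^ N)) ^ N = v9 at *
    have hu : u5 = q ^ k * (u1 * u2 * u3) / u4 := by
      rw [eq_div_iff y4k]
      exact mul_right_cancel₀ qk (by linear_combination pk)
    have hv : v9 = v5 * v6 * v7 * v8 / (q ^ N * (v1 * v2 * v3)) := by
      rw [eq_div_iff (by positivity)]
      linear_combination -pN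
    rw [hu, hv]
    clear hu hv pk pN full w1 w2 w3 w4 w5 w6
    generalize ellTheta (a * q ^ (2 * k)) p = θ1
    generalize ellTheta (a * q ^ N) p = θ2 at *
    generalize ellTheta a p = θ3 at *
    generalize ellFac (a * q / (b * c)) q p N = f1 at *
    generalize ellFac (a * q / (b * d)) q p N = f2 at *
    generalize ellFac (a * q / (c * d)) q p N = f3 at *
    generalize ellFac (a * q / (b * c * d)) q p N = f4 at *
    generalize ellFac (a ^ 2 * q ^ (1 + N) / (b * c * d)) q p N = f5 at *
    generalize ellFac (q ^ N)⁻¹ q p N = f6 at *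
    generalize ellFac (a * q / b) q p k = f7 at *
    generalize ellFac (a * q / c) q p k = f8 at *
    generalize ellFac (a * q / d) q p k = f9 at *
    generalize ellFac (a ^ 2 * q ^ (1 + N) / (b * c * d)) q p k = f10 at *
    generalize ellFac (q ^ N)⁻¹ q p k = f11 at *
    generalize ellFac a q p k = f12 at *
    generalize ellFac a q p N = f13 at *
    generalize ellFac (b * c * d / (a * q ^ N)) q p k = f14 at *
    generalize ellFac (a * q ^ (N + 1)) q p k = f15 at *
    generalize ellFac (a * q / b) q p N = f16 at *
    generalize ellFac (a * q / c) q p N = f17 at *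
    generalize ellFac (a * q / d) q p N = f18 at *
    generalize ellFac q q p k = f19 at *
    generalize ∏ i ∈ Finset.range k, -q ^ (N - 1 - i) = M1 at *
    generalize ∏ i ∈ Finset.range N, -q ^ (N - 1 - i) = M2 at *
    generalize q ^ N = Q at *
    generalize q ^ k = Q1 at *
    field_simp
  have hsum' : ∑ k ∈ Finset.range (N + 1),
      dnFactor (n := 2) q p g ![x₁, x₂] (fun _ => y) ![k, N - k] = 1 := hsum
  rw [Finset.sum_congr rfl hC, ← Finset.mul_sum] at hsum'
  rw [← inv_div, eq_inv_of_mul_eq_one_right hsum']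

/-! ### Removal of the genericity assumptions by continuity -/

theorem ContinuousAt.ellTheta {f : ℂ → ℂ} {a p : ℂ} (hp : ‖p‖ < 1) (hf : ContinuousAt f a)
    (h0 : f a ≠ 0) : ContinuousAt (fun z => ellTheta (f z) p) a :=
  (differentiableAt_ellTheta hp h0).continuousAt.comp hf

theorem ContinuousAt.ellFac {f : ℂ → ℂ} {a p q : ℂ} (hp : ‖p‖ < 1) (hq : q ≠ 0) (k : ℕ)
    (hf : ContinuousAt f a) (h0 : f a ≠ 0) : ContinuousAt (fun z => ellFac (f z) q p k) a := by
  unfold _root_.ellFac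
  exact tendsto_finsetProd _ fun j _ => ContinuousAt.ellTheta hp (hf.mul continuousAt_const)
    (mul_ne_zero h0 (pow_ne_zero _ hq))

theorem continuousAt_tenVNineTerm {a b c d q p : ℂ} {N K : ℕ} (hp : ‖p‖ < 1) (hq : q ≠ 0) (ha : a ≠ 0)
    (hb : b ≠ 0) (hc : c ≠ 0) (hd : d ≠ 0) (hθa : ellTheta a p ≠ 0)
    (hV : ellFacs [q, a * q / b, a * q / c, a * q / d, b * c * d * q ^ (-(N : ℤ)) / a,
      a * q ^ (N + 1)] q p K ≠ 0) :
    ContinuousAt (fun a => tenVNineTerm a b c d q p N K) a := by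
  have hqz : q ^ (-(N : ℤ)) ≠ 0 := zpow_ne_zero _ hq
  have id : ContinuousAt (fun z : ℂ => z) a := continuousAt_id
  simp only [tenVNineTerm, ellFacs_cons, ellFacs_nil] at hV ⊢
  refine .mul (.mul (.div (.ellTheta hp (by fun_prop) (by positivity)) (.ellTheta hp id ha) hθa)
    (.div ?_ ?_ hV)) continuousAt_const
  · exact (ContinuousAt.ellFac hp hq _ id ha).mul <| continuousAt_const.mul <|
      continuousAt_const.mul <| continuousAt_const.mul <|
      (ContinuousAt.ellFac hp hq _ (by fun_prop) (by positivity)).mul <|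
      continuousAt_const.mul continuousAt_const
  · exact continuousAt_const.mul <|
      (ContinuousAt.ellFac hp hq _ (by fun_prop) (by positivity)).mul <|
      (ContinuousAt.ellFac hp hq _ (by fun_prop) (by positivity)).mul <|
      (ContinuousAt.ellFac hp hq _ (by fun_prop) (by positivity)).mul <|
      (ContinuousAt.ellFac hp hq _ (by fun_prop (disch := assumption)) (by positivity)).mul <|
      (ContinuousAt.ellFac hp hq _ (by fun_prop) (by positivity)).mul continuousAt_const

theorem countable_ellTheta_mul_eq_zero {p κ : ℂ} (hp : ‖p‖ < 1) (hκ : κ ≠ 0) :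
    {a : ℂ | a ≠ 0 ∧ ellTheta (a * κ) p = 0}.Countable :=
  Set.Countable.mono (fun _ ha => by exact ⟨mul_ne_zero ha.1 hκ, ha.2⟩)
    ((countable_ellTheta_eq_zero hp).preimage (mul_left_injective₀ hκ))

/-- Serves the one parameter of the series that is quadratic in `a`. -/
theorem Set.Countable.preimage_sq {S : Set ℂ} (hS : S.Countable) : {a : ℂ | a ^ 2 ∈ S}.Countable := by
  have : {a : ℂ | a ^ 2 ∈ S} = ⋃ z ∈ S, {a | a ^ 2 = z} := by
    ext
    simp
  rw [this]
  refine hS.biUnion fun z _ => Set.Finite.countable ?_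
  obtain ⟨w, rfl⟩ := IsAlgClosed.exists_pow_nat_eq z two_pos
  exact (Set.toFinite {w, -w}).subset fun a ha => sq_eq_sq_iff_eq_or_eq_neg.1 ha

/-- The Frenkel–Turaev summation formula. -/
theorem sum_tenVNineTerm {a b c d q p : ℂ} {N : ℕ} (hp : ‖p‖ < 1) (hq : q ≠ 0)
    (ha : a ≠ 0) (hb : b ≠ 0) (hc : c ≠ 0) (hd : d ≠ 0) (hθa : ellTheta a p ≠ 0)
    (hV : ellFacs [q, a * q / b, a * q / c, a * q / d, b * c * d * q ^ (-(N : ℤ)) / a,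
      a * q ^ (N + 1)] q p N ≠ 0) :
    ∑ k ∈ Finset.range (N + 1), tenVNineTerm a b c d q p N k =
      ellFacs [a * q, a * q / (b * c), a * q / (b * d), a * q / (c * d)] q p N /
        ellFacs [a * q / b, a * q / c, a * q / d, a * q / (b * c * d)] q p N := by
  have hV' := hV
  simp only [ellFacs_cons, ellFacs_nil, mul_ne_zero_iff] at hV'
  obtain ⟨v1, v2, v3, v4, v5, v6, -⟩ := hV'
  let S : ℂ → Set ℂ := fun κ => {a | a ≠ 0 ∧ ellTheta (a * κ) p = 0}
  -- The values of `a` excluded from the generic case. Zeros of theta being countable, so is `B`,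
  -- and its complement is dense.
  let B : Set ℂ := {0} ∪ ⋃ j : ℕ, (S (q ^ j) ∪ S (q / b * q ^ j) ∪ S (q / c * q ^ j) ∪
    S (q / d * q ^ j) ∪ S (q / (b * c) * q ^ j) ∪ S (q / (b * d) * q ^ j) ∪
    S (q / (c * d) * q ^ j) ∪ S (q / (b * c * d) * q ^ j) ∪
    {a | a ^ 2 ∈ S (q ^ (1 + N) / (b * c * d) * q ^ j)})
  have hS : ∀ κ, κ ≠ 0 → (S κ).Countable := fun κ hκ => countable_ellTheta_mul_eq_zero hp hκ
  have hB : B.Countable := by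
    refine (Set.countable_singleton 0).union (Set.countable_iUnion fun j => ?_)
    exact ((((((((hS _ (by positivity)).union (hS _ (by positivity))).union
      (hS _ (by positivity))).union (hS _ (by positivity))).union (hS _ (by positivity))).union
      (hS _ (by positivity))).union (hS _ (by positivity))).union (hS _ (by positivity))).union
      (hS _ (by positivity)).preimage_sq
  have hne : (nhdsWithin a Bᶜ).NeBot :=
    mem_closure_iff_nhdsWithin_neBot.1 ((hB.dense_compl ℝ) a)
  have hgood : ∀ a ∈ Bᶜ, ∑ k ∈ Finset.range (N + 1), tenVNineTerm a b c d q p N k =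
      ellFacs [a * q, a * q / (b * c), a * q / (b * d), a * q / (c * d)] q p N /
        ellFacs [a * q / b, a * q / c, a * q / d, a * q / (b * c * d)] q p N := by
    intro a haB
    simp only [B, Set.mem_compl_iff, Set.mem_union, Set.mem_singleton_iff, Set.mem_iUnion, not_or,
      not_exists] at haB
    obtain ⟨ha0, haB⟩ := haB
    have key : ∀ {w κ : ℂ}, w ≠ 0 → w ∉ S κ → ellTheta (w * κ) p ≠ 0 := fun hw h h0 => h ⟨hw, h0⟩
    have key2 : ∀ {κ : ℂ}, (∀ j : ℕ, a ∉ S (κ * q ^ j)) → ellFac (a * κ) q p N ≠ 0 := fun h =>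
      ellFac_ne_zero_iff.2 fun j _ => by
        rw [mul_assoc]
        exact key ha0 (h j)
    refine sum_tenVNineTerm_of_generic hp hq ha0 hb hc hd (fun j => key ha0 ?_) v1 ?_ ?_ ?_ ?_ ?_ ?_ ?_ ?_
    · exact (haB j).1.1.1.1.1.1.1.1
    · rw [mul_div_assoc]; exact key2 fun j => (haB j).1.1.1.1.1.1.1.2
    · rw [mul_div_assoc]; exact key2 fun j => (haB j).1.1.1.1.1.1.2
    · rw [mul_div_assoc]; exact key2 fun j => (haB j).1.1.1.1.1.2
    · rw [mul_div_assoc]; exact key2 fun j => (haB j).1.1.1.1.2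
    · rw [mul_div_assoc]; exact key2 fun j => (haB j).1.1.1.2
    · rw [mul_div_assoc]; exact key2 fun j => (haB j).1.1.2
    · rw [mul_div_assoc]; exact key2 fun j => (haB j).1.2
    · rw [mul_div_assoc]
      refine ellFac_ne_zero_iff.2 fun j _ => ?_
      rw [mul_assoc]
      exact key (pow_ne_zero 2 ha0) (haB j).2
  -- The one denominator on the right that is absent from `hV` is the reversal of `(b c d q^(-N) /
  -- a)_N`.
  have v7 : ellFac (a * q / (b * c * d)) q p N ≠ 0 :=
    ellFac_ne_zero_of_reverse hp hq (by rw [zpow_neg, zpow_natCast]; field_simp) v5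
  have id : ContinuousAt (fun z : ℂ => z) a := continuousAt_id
  have hL : ContinuousAt (fun a => ∑ k ∈ Finset.range (N + 1), tenVNineTerm a b c d q p N k) a := by
    refine tendsto_finsetSum _ fun k hk => ?_
    have hk : k ≤ N := Nat.lt_succ_iff.1 (Finset.mem_range.1 hk)
    refine continuousAt_tenVNineTerm hp hq ha hb hc hd hθa ?_
    simp only [ellFacs_cons, ellFacs_nil, mul_ne_zero_iff]
    exact ⟨ellFac_ne_zero_of_le v1 hk, ellFac_ne_zero_of_le v2 hk, ellFac_ne_zero_of_le v3 hk,
      ellFac_ne_zero_of_le v4 hk, ellFac_ne_zero_of_le v5 hk, ellFac_ne_zero_of_le v6 hk, one_ne_zero⟩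
  have hR : ContinuousAt (fun a =>
      ellFacs [a * q, a * q / (b * c), a * q / (b * d), a * q / (c * d)] q p N /
        ellFacs [a * q / b, a * q / c, a * q / d, a * q / (b * c * d)] q p N) a := by
    have hf : ∀ κ : ℂ, κ ≠ 0 → ContinuousAt (fun a => ellFac (a * q / κ) q p N) a := fun κ hκ =>
      ContinuousAt.ellFac hp hq _ (by fun_prop) (by positivity)
    simp only [ellFacs_cons, ellFacs_nil]
    refine .div ?_ ?_ ?_
    · exact (ContinuousAt.ellFac hp hq _ (by fun_prop) (by positivity)).mul <|
        (hf _ (by positivity)).mul <| (hf _ (by positivity)).mul <|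
        (hf _ (by positivity)).mul continuousAt_const
    · exact (hf _ hb).mul <| (hf _ hc).mul <| (hf _ hd).mul <|
        (hf _ (by positivity)).mul continuousAt_const
    · simp only [mul_ne_zero_iff]
      exact ⟨v2, v3, v4, v7, one_ne_zero⟩
  exact tendsto_nhds_unique_of_eventuallyEq (hL.tendsto.mono_left nhdsWithin_le_nhds)
    (hR.tendsto.mono_left nhdsWithin_le_nhds) (eventually_nhdsWithin_of_forall hgood)

/-! ### Summation over the levels `|k| = K` -/

theorem sum_multiSimplex {n N : ℕ} {M : Type*} [AddCommMonoid M] (F : (Fin n → ℕ) → M) :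
    ∑ k ∈ multiSimplex n N, F k =
      ∑ K ∈ Finset.range (N + 1), ∑ k ∈ Finset.Nat.antidiagonalTuple n K, F k := by
  rw [← Finset.sum_fiberwise_of_maps_to (s := multiSimplex n N) (t := Finset.range (N + 1))
    (g := fun k => ∑ r, k r) fun k hk =>
      Finset.mem_range.2 (Nat.lt_succ_of_le (mem_multiSimplex.1 hk))]
  refine Finset.sum_congr rfl fun K hK => Finset.sum_congr ?_ fun _ _ => rfl
  ext k
  have := Finset.mem_range.1 hK
  rw [Finset.mem_filter, mem_multiSimplex, Finset.Nat.mem_antidiagonalTuple]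
  omega

theorem mainTheorem5 (n N : ℕ) (hn : 1 ≤ n)
    (q p q' p' : ℂ) (hq : q ≠ 0) (hp : ‖p‖ < 1) (hq' : q' ≠ 0) (hp' : ‖p'‖ < 1)
    (x : Fin n → ℂ) (y : Fin (n - 1) → ℂ) (g a b c d : ℂ)
    (hx : ∀ r, x r ≠ 0) (hy : ∀ s, y s ≠ 0) (hg : g ≠ 0)
    (ha : a ≠ 0) (hb : b ≠ 0) (hc : c ≠ 0) (hd : d ≠ 0)
    -- no denominator on the left-hand side vanishes
    (hxx : ∀ r s, r < s → ellTheta (x r / x s) p ≠ 0 ∧ ellFac (x r * x s) q p N ≠ 0)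
    (hgy : ∀ s, ellFacs [g * y s, g / y s] q p N ≠ 0)
    (hgx : ∀ r, ellFac (g * x r) q p N ≠ 0)
    (hqx : ∀ r s, ellFac (q * x r / x s) q p N ≠ 0)
    (hθa : ellTheta a p' ≠ 0)
    (hV : ellFacs [q', a * q' / b, a * q' / c, a * q' / d, b * c * d * q' ^ (-(N : ℤ)) / a,
      a * q' ^ (N + 1)] q' p' N ≠ 0) :
    ∑ k ∈ multiSimplex n N,
        dnFactor q p g x y k * tenVNineTerm a b c d q' p' N (∑ i, k i) =
      ellFacs [a * q', a * q' / (b * c), a * q' / (b * d), a * q' / (c * d)] q' p' N /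
        ellFacs [a * q' / b, a * q' / c, a * q' / d, a * q' / (b * c * d)] q' p' N := by
  rw [sum_multiSimplex, ← sum_tenVNineTerm hp' hq' ha hb hc hd hθa hV]
  refine Finset.sum_congr rfl fun K hK => ?_
  have h := sum_dnFactor_eq_one hn hp hq hx hy hg hxx hgy hgx hqx
    (Nat.lt_succ_iff.1 (Finset.mem_range.1 hK))
  rw [Finset.sum_congr rfl fun k hk => by rw [Finset.Nat.mem_antidiagonalTuple.1 hk],
    ← Finset.sum_mul, h, one_mul]
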